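/- For $n\ge 1$, signs $\vec\epsilon\in\{\pm1\}^n$ and Schwartz functions $f_1,\dots,f_n$ on $\mathbb R$ put $$C_n^{\vec\epsilon}(f_1,\dots,f_n)(x)=\int_{\xi_1<\dots<\xi_n}\hat f_1(\xi_1)\cdots\hat f_n(\xi_n)\,e^{2\pi i x(\epsilon_1\xi_1+\dots+\epsilon_n\xi_n)}\,d\xi_1\cdots d\xi_n ,\qquad \hat f(\xi)=\int_{\mathbb R} f(y)e^{-2\pi i y\xi}\,dy .$$ For $1\le p\le\infty$ let $W_p=\{f\in L^p(\mathbb R):\hat f\in L^{p'}(\mathbb R)\}$ with norm $\|f\|_{W_p}=\|\hat f\|_{L^{p'}}$, where $\frac1p+\frac1{p'}=1$. Let $n\ge2$ and $\vec\epsilon\in\{\pm1\}^n$. For every $1\le i\le n$ let either $X^i=L^{p_i}(\mathbb R)$ with $1<p_i<\infty$, or $X^i=W_{p_i}$ with $1\le p_i\le\infty$, $p_i\ne2$; let $W^*\subseteq\{1,\dots,n\}$ be the set of those $i$ for which the choice is $X^i=W_{p_i}$. Suppose that (a) if $i\in W^*$, then $\epsilon_i+\epsilon_j=0$ for each neighbour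 $j\in\{i-1,i+1\}\cap\{1,\dots,n\}$; (b) if $1\le i\le n-1$ and $\epsilon_i+\epsilon_{i+1}=0$, then $\frac1{p_i}+\frac1{p_{i+1}}\ne1$. Suppose that $C_n^{\vec\epsilon}$ is bounded from $X^1\times\dots\times X^n$ into $L^q(\mathbb R)$, where $\frac1q=\sum_{i=1}^n\frac1{p_i}$; that is, there is a constant $C<\infty$ with $$\|C_n^{\vec\epsilon}(f_1,\dots,f_n)\|_{L^q}\le C\prod_{i=1}^n\|f_i\|_{X^i}\qquad\text{for all Schwartz functions } f_1,\dots,f_n .$$ Then (1) $p_i>2$ for all $i\in W^*$; (2) for every $2\le i\le n-1$ such that $\epsilon_{i-1}+\epsilon_i=0$ or $\epsilon_i+\epsilon_{i+1}=0$, one has $\{i-1,i,i+1\}\cap W^*\neq\emptyset$; (3) for every $1\le i\le n-1$ such that $\epsilon_i+\epsilon_{i+1}=0$, one has $\frac1{p_i}+\frac1{p_{i+1}}<1$. -/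

import Mathlib

open MeasureTheory
open scoped ENNReal NNReal FourierTransform SchwartzMap

noncomputable section

/-- The operator
`C_n^ε(f₁,…,fₙ)(x) = ∫_{ξ₁ < ⋯ < ξₙ} f̂₁(ξ₁) ⋯ f̂ₙ(ξₙ) exp (2 π i x (ε · ξ)) dξ`,
where `f̂(ξ) = ∫ f(y) exp (-2 π i y ξ) dy`. The integral converges absolutely
for Schwartz functions. -/
def orderedOscOp {n : ℕ} (ε : Fin n → ℤˣ) (f : Fin n → ℝ → ℂ) (x : ℝ) : ℂ :=
  ∫ ξ in {ξ : Fin n → ℝ | StrictMono ξ},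
    (∏ i, 𝓕 (f i) (ξ i)) *
      Complex.exp (2 * Real.pi * Complex.I * x * ∑ i, ((ε i : ℤ) : ℂ) * (ξ i : ℂ))

/-- A choice of factor of the domain: a Lebesgue space `L^p` or a Wiener space `W_p`. -/
inductive FactorSpace where
  | lebesgue (p : ℝ≥0∞)
  | wiener (p : ℝ≥0∞)

namespace FactorSpace

/-- The exponent `p` of `L^p` or `W_p`. -/
def exponent : FactorSpace → ℝ≥0∞
  | lebesgue p => p
  | wiener p => p

/-- The factor is a Wiener space. -/
def IsWiener : FactorSpace → Prop
  | lebesgue _ => False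
  | wiener _ => True

/-- The exponents allowed: `1 < p < ∞` for `L^p`, and `1 ≤ p ≤ ∞`, `p ≠ 2` for `W_p`. -/
def Admissible : FactorSpace → Prop
  | lebesgue p => 1 < p ∧ p < ∞
  | wiener p => 1 ≤ p ∧ p ≠ 2

/-- The norm of `L^p`, which is `‖f‖_p`, or of `W_p`, which is `‖f̂‖_{p'}` with `1/p + 1/p' = 1`. -/
def norm : FactorSpace → (ℝ → ℂ) → ℝ≥0∞
  | lebesgue p, f => eLpNorm f p volume
  | wiener p, f => eLpNorm (𝓕 f) (ENNReal.conjExponent p) volume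

end FactorSpace

/-- `C_n^ε : X¹ × ⋯ × Xⁿ → L^q` is bounded, where `1/q = ∑ 1/pᵢ`: the estimate
`‖C_n^ε(f₁,…,fₙ)‖_q ≤ C ∏ ‖fᵢ‖_{Xⁱ}` holds on Schwartz functions (these belong to all the spaces
`L^p` and `W_p`), with a constant that does not depend on the functions. -/
def IsMixedBounded {n : ℕ} (ε : Fin n → ℤˣ) (X : Fin n → FactorSpace) : Prop :=
  ∃ C : ℝ≥0, ∀ f : Fin n → 𝓢(ℝ, ℂ),
    eLpNorm (orderedOscOp ε fun i => ⇑(f i)) (∑ i, (X i).exponent⁻¹)⁻¹ volume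
      ≤ C * ∏ i, (X i).norm (f i)

/-- A sign degeneracy occurs between the indices `i` and `j` (used for consecutive indices). -/
def SignDegenerate {n : ℕ} (ε : Fin n → ℤˣ) (i j : Fin n) : Prop :=
  (ε i : ℤ) + (ε j : ℤ) = 0

end

open Filter Topology

/-! All three conclusions come from testing the estimate on inputs modulated far apart. Replacing `f
i` by its modulation at frequency `M * c i` leaves every factor norm unchanged and, up to a
unimodular phase, only translates the region of integration. As `M → ∞` the constraint `ξ i < ξ j`
disappears if `c i < c j`, becomes impossible if `c i > c j`, and survives if `c i = c j`. The
convergence is uniform in `x`, so the bound can be tested on the operators with region `limitSector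
c`. Three such regions are used: everything, where the operator is the product of the functions `f i
(ε i * x)`; nothing; and a single constraint `ξ a < ξ b` with opposite signs, where the pair
contributes the Cauchy integral of `f a y * f b (-y)` at `ε a * x` (`sectorOp_pair`).

Wiener exponents: with the product as limit operator, put a Gaussian chirp in the Wiener slot. It
stays bounded below on `[-1, 1]`, while its transform is bounded in `L²` and uniformly small, hence
small in `L^{p'}` when `p' > 2`. So `p < 2` is impossible, and `p = 2` is excluded by admissibility.

Neighbouring exponents: keep one constraint and put bumps of width about `1/R` in the degenerate
pair. At distance about one the Cauchy integral is at least a multiple of `1/R`, while the norms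
contribute `R ^ (-s)` with `s` the sum of the two inverse exponents. Letting `R → ∞` gives `s ≤ 1`;
equality is excluded by hypothesis.

Wiener factor in each block: if three consecutive factors `a`, `b`, `d` are all Lebesgue spaces and
the pair `a`, `b` is degenerate, use in each slot a sum of `N` bumps on disjoint tiles, modulated at
different frequencies. Disjointness bounds the Lebesgue norms independently of `N`. The frequencies
are arranged so that on tile `m` the only surviving terms have tile `k < m` in slots `a`, `b` and
tile `m` in slot `d`. Each is a Cauchy integral of size at least a multiple of `1/(m - k)`, all with
a common phase because the signs of the pair cancel. The output is bounded below by a harmonic sum,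
which diverges. -/

/-! ### Fourier inversion and modulation of Schwartz functions. -/

/-- The Fourier transform of a Schwartz function, as a Schwartz function. -/
noncomputable def schwartzHat (f : 𝓢(ℝ, ℂ)) : 𝓢(ℝ, ℂ) := 𝓕 f

theorem fourier_coe_eq_schwartzHat (f : 𝓢(ℝ, ℂ)) : 𝓕 (f : ℝ → ℂ) = schwartzHat f := rfl

theorem schwartzHat_apply (f : 𝓢(ℝ, ℂ)) (ξ : ℝ) :
    schwartzHat f ξ = ∫ y : ℝ, Complex.exp (-(2 * Real.pi * Complex.I * y * ξ)) * f y := by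
  rw [← fourier_coe_eq_schwartzHat, Real.fourier_eq']
  refine integral_congr_ae (Eventually.of_forall fun y => ?_)
  simp only [smul_eq_mul, RCLike.inner_apply, conj_trivial]
  congr 2
  push_cast
  ring

theorem integral_schwartzHat_mul_exp (f : 𝓢(ℝ, ℂ)) (y : ℝ) :
    ∫ ξ : ℝ, schwartzHat f ξ * Complex.exp (2 * Real.pi * Complex.I * y * ξ) = f y := by
  have h : (𝓕⁻ (𝓕 f : 𝓢(ℝ, ℂ)) : 𝓢(ℝ, ℂ)) = f := FourierPair.fourierInv_fourier_eq f
  have h2 : (𝓕⁻ (𝓕 f : 𝓢(ℝ, ℂ)) : 𝓢(ℝ, ℂ)) y = f y := by rw [h]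
  rw [SchwartzMap.fourierInv_coe, Real.fourierInv_eq'] at h2
  rw [← h2]
  refine integral_congr_ae (Eventually.of_forall fun ξ => ?_)
  simp only [smul_eq_mul, RCLike.inner_apply, conj_trivial]
  rw [mul_comm]
  congr 2
  push_cast
  ring

/-- The modulation `y ↦ exp (2 π i a y) f y` of a Schwartz function. -/
noncomputable def modulate (a : ℝ) (f : 𝓢(ℝ, ℂ)) : 𝓢(ℝ, ℂ) :=
  𝓕⁻ (SchwartzMap.compSubConstCLM ℂ a (schwartzHat f))

theorem schwartzHat_modulate (a : ℝ) (f : 𝓢(ℝ, ℂ)) (ξ : ℝ) :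
    schwartzHat (modulate a f) ξ = schwartzHat f (ξ - a) := by
  have h : schwartzHat (modulate a f) = SchwartzMap.compSubConstCLM ℂ a (schwartzHat f) :=
    FourierInvPair.fourier_fourierInv_eq _
  rw [h, SchwartzMap.compSubConstCLM_apply]

theorem modulate_apply (a : ℝ) (f : 𝓢(ℝ, ℂ)) (y : ℝ) :
    modulate a f y = Complex.exp (2 * Real.pi * Complex.I * a * y) * f y := by
  rw [← integral_schwartzHat_mul_exp (modulate a f), ← integral_schwartzHat_mul_exp f,
    ← integral_const_mul, ← integral_add_right_eq_self (fun ξ : ℝ => schwartzHat (modulate a f) ξ *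
      Complex.exp (2 * Real.pi * Complex.I * y * ξ)) a]
  refine integral_congr_ae (Eventually.of_forall fun ξ => ?_)
  simp only [schwartzHat_modulate, add_sub_cancel_right]
  rw [mul_left_comm, ← Complex.exp_add]
  congr 2
  push_cast
  ring

theorem schwartzHat_schwartzHat (f : 𝓢(ℝ, ℂ)) (y : ℝ) :
    schwartzHat (schwartzHat f) y = f (-y) := by
  rw [schwartzHat_apply, ← integral_schwartzHat_mul_exp f]
  refine integral_congr_ae (Eventually.of_forall fun ξ => ?_)
  simp only
  rw [mul_comm]
  congr 2
  push_cast
  ring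

theorem norm_modulate (a : ℝ) (f : 𝓢(ℝ, ℂ)) (y : ℝ) : ‖modulate a f y‖ = ‖f y‖ := by
  rw [modulate_apply, norm_mul]
  have : 2 * (Real.pi : ℂ) * Complex.I * a * y = ((2 * Real.pi * a * y : ℝ) : ℂ) * Complex.I := by
    push_cast; ring
  rw [this, Complex.norm_exp_ofReal_mul_I, one_mul]

/-! ### The operator over a general frequency region. -/

/-- The Fourier multiplier form of `orderedOscOp` over a general frequency region. -/
noncomputable def sectorOp {n : ℕ} (S : Set (Fin n → ℝ)) (ε : Fin n → ℤˣ) (f : Fin n → ℝ → ℂ)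
    (x : ℝ) : ℂ :=
  ∫ ξ in S, (∏ i, 𝓕 (f i) (ξ i)) *
    Complex.exp (2 * Real.pi * Complex.I * x * ∑ i, ((ε i : ℤ) : ℂ) * (ξ i : ℂ))

/-- The wave `exp (2 π i x (ε · ξ))`. -/
noncomputable def signedWave {n : ℕ} (ε : Fin n → ℤˣ) (x : ℝ) (ξ : Fin n → ℝ) : ℂ :=
  Complex.exp (2 * Real.pi * Complex.I * x * ∑ i, ((ε i : ℤ) : ℂ) * (ξ i : ℂ))

theorem norm_signedWave {n : ℕ} (ε : Fin n → ℤˣ) (x : ℝ) (ξ : Fin n → ℝ) :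
    ‖signedWave ε x ξ‖ = 1 := by
  have : 2 * (Real.pi : ℂ) * Complex.I * x * ∑ i, ((ε i : ℤ) : ℂ) * (ξ i : ℂ)
      = ((2 * Real.pi * x * ∑ i, ((ε i : ℤ) : ℝ) * ξ i : ℝ) : ℂ) * Complex.I := by
    push_cast; ring
  rw [signedWave, this, Complex.norm_exp_ofReal_mul_I]

theorem continuous_signedWave {n : ℕ} (ε : Fin n → ℤˣ) (x : ℝ) :
    Continuous (signedWave ε x) := by
  unfold signedWave
  fun_prop

theorem signedWave_eq_prod {n : ℕ} (ε : Fin n → ℤˣ) (x : ℝ) (ξ : Fin n → ℝ) :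
    signedWave ε x ξ
      = ∏ i, Complex.exp (2 * Real.pi * Complex.I * (((ε i : ℤ) : ℝ) * x : ℝ) * ξ i) := by
  rw [signedWave, ← Complex.exp_sum, Finset.mul_sum]
  congr 1
  refine Finset.sum_congr rfl fun i _ => ?_
  push_cast
  ring

theorem signedWave_add {n : ℕ} (ε : Fin n → ℤˣ) (x : ℝ) (ξ η : Fin n → ℝ) :
    signedWave ε x (ξ + η) = signedWave ε x ξ * signedWave ε x η := by
  simp only [signedWave, ← Complex.exp_add, ← mul_add, ← Finset.sum_add_distrib]
  simp [mul_add]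

theorem sectorOp_eq {n : ℕ} (S : Set (Fin n → ℝ)) (ε : Fin n → ℤˣ) (f : Fin n → 𝓢(ℝ, ℂ)) (x : ℝ) :
    sectorOp S ε (fun i => ⇑(f i)) x
      = ∫ ξ in S, (∏ i, schwartzHat (f i) (ξ i)) * signedWave ε x ξ := rfl

theorem orderedOscOp_eq_sectorOp {n : ℕ} (ε : Fin n → ℤˣ) (f : Fin n → ℝ → ℂ) (x : ℝ) :
    orderedOscOp ε f x = sectorOp {ξ | StrictMono ξ} ε f x := rfl

theorem integrable_prod_schwartz {n : ℕ} (g : Fin n → 𝓢(ℝ, ℂ)) :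
    Integrable (fun ξ : Fin n → ℝ => ∏ i, g i (ξ i)) :=
  Integrable.fintype_prod fun i => (g i).integrable

theorem integrable_sectorOp_integrand {n : ℕ} (ε : Fin n → ℤˣ) (f : Fin n → 𝓢(ℝ, ℂ)) (x : ℝ) :
    Integrable (fun ξ : Fin n → ℝ => (∏ i, schwartzHat (f i) (ξ i)) * signedWave ε x ξ) := by
  refine (integrable_prod_schwartz fun i => schwartzHat (f i)).mul_bdd (c := 1)
    (continuous_signedWave ε x).aestronglyMeasurable ?_
  exact Eventually.of_forall fun ξ => (norm_signedWave ε x ξ).le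

theorem measurableSet_strictMono {n : ℕ} : MeasurableSet {ξ : Fin n → ℝ | StrictMono ξ} := by
  have : {ξ : Fin n → ℝ | StrictMono ξ} = ⋂ i, ⋂ j, ⋂ (_ : i < j), {ξ | ξ i < ξ j} := by
    ext ξ
    simp [StrictMono]
  rw [this]
  refine MeasurableSet.iInter fun i => MeasurableSet.iInter fun j => MeasurableSet.iInter fun _ => ?_
  exact measurableSet_lt (measurable_pi_apply i) (measurable_pi_apply j)

/-- Translate `ξ` by `a`: the transforms return to their original position, the wave splits off a
unimodular factor, and only the region moves. -/
theorem orderedOscOp_modulate {n : ℕ} (ε : Fin n → ℤˣ) (f : Fin n → 𝓢(ℝ, ℂ)) (a : Fin n → ℝ)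
    (x : ℝ) :
    orderedOscOp ε (fun i => ⇑(modulate (a i) (f i))) x
      = signedWave ε x a * sectorOp {ξ | StrictMono (ξ + a)} ε (fun i => ⇑(f i)) x := by
  rw [orderedOscOp_eq_sectorOp, sectorOp_eq, sectorOp_eq]
  have hm : MeasurableSet {ξ : Fin n → ℝ | StrictMono (ξ + a)} :=
    (measurable_id.add_const a) measurableSet_strictMono
  rw [← integral_indicator measurableSet_strictMono, ← integral_indicator hm,
    ← integral_const_mul, ← integral_add_right_eq_self _ a]
  refine integral_congr_ae (Eventually.of_forall fun ξ => ?_)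
  simp only [Set.indicator_apply, Set.mem_ofPred_eq]
  split_ifs
  · rw [signedWave_add]
    simp only [schwartzHat_modulate, Pi.add_apply, add_sub_cancel_right]
    ring
  · simp

/-- The wave has modulus one, so the difference is at most the integral of the product of transforms
over the symmetric difference of the regions. That bound does not involve `x` and tends to zero by
dominated convergence. -/
theorem eventually_norm_sectorOp_sub_le {n : ℕ} (ε : Fin n → ℤˣ) (f : Fin n → 𝓢(ℝ, ℂ))
    {S : ℕ → Set (Fin n → ℝ)} {T : Set (Fin n → ℝ)} (hS : ∀ M, MeasurableSet (S M))
    (hT : MeasurableSet T) (h : ∀ ξ, ∀ᶠ M in atTop, (ξ ∈ S M ↔ ξ ∈ T)) {η : ℝ} (hη : 0 < η) :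
    ∀ᶠ M in atTop, ∀ x,
      ‖sectorOp (S M) ε (fun i => ⇑(f i)) x - sectorOp T ε (fun i => ⇑(f i)) x‖ ≤ η := by
  set G : (Fin n → ℝ) → ℂ := fun ξ => ∏ i, schwartzHat (f i) (ξ i) with hG
  have hGi : Integrable G := integrable_prod_schwartz fun i => schwartzHat (f i)
  have hind : ∀ M, Integrable (fun ξ => (S M).indicator G ξ - T.indicator G ξ) := fun M =>
    (hGi.indicator (hS M)).sub (hGi.indicator hT)
  have key : Tendsto (fun M => ∫ ξ, ‖(S M).indicator G ξ - T.indicator G ξ‖) atTop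
      (𝓝 (∫ _ : Fin n → ℝ, (0 : ℝ))) := by
    refine tendsto_integral_of_dominated_convergence (fun ξ => 2 * ‖G ξ‖)
      (fun M => (hind M).norm.aestronglyMeasurable) (hGi.norm.const_mul 2) (fun M => ?_) ?_
    · refine Eventually.of_forall fun ξ => ?_
      rw [norm_norm, two_mul]
      exact (norm_sub_le _ _).trans
        (add_le_add (norm_indicator_le_norm_self _ _) (norm_indicator_le_norm_self _ _))
    · refine Eventually.of_forall fun ξ => tendsto_const_nhds.congr' ?_
      filter_upwards [h ξ] with M hM
      by_cases hx : ξ ∈ T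
      · simp [hx, hM.2 hx]
      · simp [hx, mt hM.1 hx]
  rw [integral_zero] at key
  filter_upwards [key.eventually (eventually_le_nhds hη)] with M hM x
  refine le_trans ?_ hM
  have hI := integrable_sectorOp_integrand ε f x
  rw [sectorOp_eq, sectorOp_eq, ← integral_indicator (hS M), ← integral_indicator hT,
    ← integral_sub (hI.indicator (hS M)) (hI.indicator hT)]
  refine (norm_integral_le_integral_norm _).trans_eq ?_
  refine integral_congr_ae (Eventually.of_forall fun ξ => ?_)
  have e : ∀ A : Set (Fin n → ℝ), A.indicator
      (fun ξ => (∏ i, schwartzHat (f i) (ξ i)) * signedWave ε x ξ) ξ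
        = A.indicator G ξ * signedWave ε x ξ := fun A => by
    by_cases hA : ξ ∈ A <;> simp [hA, hG]
  simp only [e, ← sub_mul, norm_mul, norm_signedWave, mul_one]

theorem orderedOscOp_sum {n : ℕ} (ε : Fin n → ℤˣ) (t : Fin n → Finset ℕ)
    (G : Fin n → ℕ → 𝓢(ℝ, ℂ)) (x : ℝ) :
    orderedOscOp ε (fun i => ⇑(∑ k ∈ t i, G i k)) x
      = ∑ κ ∈ Fintype.piFinset t, orderedOscOp ε (fun i => ⇑(G i (κ i))) x := by
  simp only [orderedOscOp_eq_sectorOp, sectorOp_eq]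
  rw [← integral_finsetSum]
  · refine integral_congr_ae (Eventually.of_forall fun ξ => ?_)
    simp only
    rw [← Finset.sum_mul, ← Finset.prod_univ_sum t fun i k => schwartzHat (G i k) (ξ i)]
    congr 1
    refine Finset.prod_congr rfl fun i _ => ?_
    have : schwartzHat (∑ k ∈ t i, G i k) = ∑ k ∈ t i, schwartzHat (G i k) := by
      simp only [schwartzHat]
      exact map_sum (SchwartzMap.fourierTransformCLM ℂ) _ _
    rw [this, sum_apply]
  · exact fun κ _ => (integrable_sectorOp_integrand ε _ x).integrableOn

theorem sectorOp_univ {n : ℕ} (ε : Fin n → ℤˣ) (f : Fin n → 𝓢(ℝ, ℂ)) (x : ℝ) :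
    sectorOp Set.univ ε (fun i => ⇑(f i)) x = ∏ i, f i (((ε i : ℤ) : ℝ) * x) := by
  rw [sectorOp_eq, setIntegral_univ]
  simp only [signedWave_eq_prod, ← Finset.prod_mul_distrib]
  rw [integral_fintype_prod_volume_eq_prod (fun i (ξ : ℝ) => schwartzHat (f i) ξ *
    Complex.exp (2 * Real.pi * Complex.I * (((ε i : ℤ) : ℝ) * x : ℝ) * ξ))]
  exact Finset.prod_congr rfl fun i _ => integral_schwartzHat_mul_exp _ _

theorem sectorOp_empty {n : ℕ} (ε : Fin n → ℤˣ) (f : Fin n → 𝓢(ℝ, ℂ)) (x : ℝ) :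
    sectorOp ∅ ε (fun i => ⇑(f i)) x = 0 := by
  simp [sectorOp_eq]

/-! ### A single order constraint as a Cauchy integral. -/

/-- The self-adjointness of the Fourier transform, applied to `f` and the transform of a modulation
of `g`; transforming twice produces the reflection `g (-y)`. -/
theorem integral_schwartzHat_mul_schwartzHat_add (f g : 𝓢(ℝ, ℂ)) (t : ℝ) :
    ∫ ξ, schwartzHat f ξ * schwartzHat g (ξ + t)
      = ∫ y : ℝ, f y * g (-y) * Complex.exp (2 * Real.pi * Complex.I * y * t) := by
  have h := SchwartzMap.integral_fourier_mul_eq f (schwartzHat (modulate (-t) g))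
  change ∫ ξ, schwartzHat f ξ * schwartzHat (modulate (-t) g) ξ
    = ∫ y, f y * schwartzHat (schwartzHat (modulate (-t) g)) y at h
  simp only [schwartzHat_modulate, sub_neg_eq_add, schwartzHat_schwartzHat, modulate_apply] at h
  rw [h]
  refine integral_congr_ae (Eventually.of_forall fun y => ?_)
  simp only
  rw [mul_comm (Complex.exp _), ← mul_assoc]
  congr 2
  push_cast
  ring

/-- The oscillatory integral over a half line of the Fourier transform of a function that vanishes
near the base point `u` is a Cauchy integral. -/
theorem integral_Ioi_fourier_eq_cauchy {h : ℝ → ℂ} (hh : Integrable h) {u δ : ℝ} (hδ : 0 < δ)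
    (hu : ∀ y, |y - u| < δ → h y = 0)
    (hi : IntegrableOn
      (fun t : ℝ => ∫ y : ℝ, h y * Complex.exp (2 * Real.pi * Complex.I * (y - u) * t))
      (Set.Ioi 0)) :
    ∫ t in Set.Ioi (0 : ℝ), ∫ y : ℝ, h y * Complex.exp (2 * Real.pi * Complex.I * (y - u) * t)
      = (2 * Real.pi * Complex.I)⁻¹ * ∫ y : ℝ, h y / (u - y) := by
  have hpi : (2 * Real.pi * Complex.I : ℂ) ≠ 0 := Complex.two_pi_I_ne_zero
  -- Since `h` vanishes near `u`, the quotient is integrable, and its transform `G` is an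
  -- antiderivative of the integrand up to the factor `-(2 π i)`. Riemann–Lebesgue kills `G` at
  -- infinity, so only `G 0`, the Cauchy integral, remains.
  set g : ℝ → ℂ := fun y => h y / (u - y) with hg
  have hgm : AEStronglyMeasurable g := by
    exact (hh.aestronglyMeasurable.aemeasurable.div
      (by fun_prop : Measurable fun y : ℝ => (u : ℂ) - y).aemeasurable).aestronglyMeasurable
  have hgi : Integrable g := by
    refine (hh.norm.const_mul δ⁻¹).mono' hgm (Eventually.of_forall fun y => ?_)
    by_cases hy : |y - u| < δ
    · simp [hg, hu y hy]
    · push Not at hy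
      have : ‖(u : ℂ) - y‖ = |y - u| := by
        rw [← Complex.ofReal_sub, Complex.norm_real, Real.norm_eq_abs, abs_sub_comm]
      rw [hg, norm_div, this, div_eq_inv_mul]
      gcongr
  have hgu : ∀ y : ℝ, g y * (y - u) = -h y := fun y => by
    by_cases hy : y = u
    · simp [hy, hu u (by simpa using hδ)]
    · have : (u : ℂ) - y ≠ 0 := sub_ne_zero.2 (by exact_mod_cast Ne.symm hy)
      rw [hg]
      field_simp
      ring
  have hexp : ∀ y t : ℝ, ‖Complex.exp (2 * Real.pi * Complex.I * (y - u) * t)‖ = 1 := fun y t => by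
    have : 2 * (Real.pi : ℂ) * Complex.I * (y - u) * t
        = ((2 * Real.pi * (y - u) * t : ℝ) : ℂ) * Complex.I := by
      push_cast; ring
    rw [this, Complex.norm_exp_ofReal_mul_I]
  have hem : ∀ t : ℝ, AEStronglyMeasurable
      (fun y : ℝ => Complex.exp (2 * Real.pi * Complex.I * (y - u) * t)) := fun t =>
    (by fun_prop : Continuous fun y : ℝ =>
      Complex.exp (2 * Real.pi * Complex.I * (y - u) * t)).aestronglyMeasurable
  set G : ℝ → ℂ := fun t => ∫ y : ℝ, g y * Complex.exp (2 * Real.pi * Complex.I * (y - u) * t)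
    with hG
  have hGd : ∀ t : ℝ, HasDerivAt G (-(2 * Real.pi * Complex.I) *
      ∫ y : ℝ, h y * Complex.exp (2 * Real.pi * Complex.I * (y - u) * t)) t := fun t => by
    have := hasDerivAt_integral_of_dominated_loc_of_deriv_le (μ := volume) (𝕜 := ℝ)
      (F := fun (t : ℝ) (y : ℝ) => g y * Complex.exp (2 * Real.pi * Complex.I * (y - u) * t))
      (F' := fun (t : ℝ) (y : ℝ) => -(2 * Real.pi * Complex.I) *
        (h y * Complex.exp (2 * Real.pi * Complex.I * (y - u) * t)))
      (x₀ := t) (s := Set.univ) (bound := fun y => ‖(2 * Real.pi * Complex.I : ℂ)‖ * ‖h y‖)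
      univ_mem (Eventually.of_forall fun t => hgm.mul (hem t))
      (hgi.mul_bdd (c := 1) (hem t) (Eventually.of_forall fun y => (hexp y t).le))
      ((hh.aestronglyMeasurable.mul (hem t)).const_mul _)
      (Eventually.of_forall fun y t _ => by rw [norm_mul, norm_mul, hexp, norm_neg, mul_one])
      (hh.norm.const_mul _)
      (Eventually.of_forall fun y t _ => by
        have h1 : HasDerivAt (fun t : ℝ => (2 * Real.pi * Complex.I * (y - u) : ℂ) * t)
            (2 * Real.pi * Complex.I * (y - u)) t := by
          simpa using (Complex.ofRealCLM.hasDerivAt (x := t)).const_mul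
            (2 * Real.pi * Complex.I * (y - u) : ℂ)
        have h2 := (h1.cexp).const_mul (g y)
        refine h2.congr_deriv ?_
        linear_combination Complex.exp (2 * Real.pi * Complex.I * (y - u) * t) *
          (2 * Real.pi * Complex.I) * hgu y)
    rw [← integral_const_mul]
    exact this.2
  have hlim : Tendsto G atTop (𝓝 0) := by
    have hc := Real.zero_at_infty_fourier (fun y => g (-y + u))
    have ht : Tendsto (𝓕 fun y => g (-y + u)) atTop (𝓝 0) :=
      hc.mono_left atTop_le_cocompact
    refine ht.congr fun t => ?_
    rw [Real.fourier_eq', hG]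
    simp only
    rw [← integral_add_right_eq_self (fun y : ℝ => g y *
        Complex.exp (2 * Real.pi * Complex.I * (y - u) * t)) u,
      ← integral_neg_eq_self (fun y : ℝ => g (y + u) *
        Complex.exp (2 * Real.pi * Complex.I * ((y + u : ℝ) - u) * t))]
    refine integral_congr_ae (Eventually.of_forall fun y => ?_)
    simp only [smul_eq_mul, RCLike.inner_apply, conj_trivial]
    rw [mul_comm]
    congr 2
    push_cast
    ring
  have hF := integral_Ioi_of_hasDerivAt_of_tendsto (a := 0)
    (hGd 0).continuousAt.continuousWithinAt (fun t _ => hGd t) (hi.const_mul _) hlim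
  rw [integral_const_mul] at hF
  have hG0 : G 0 = ∫ y, g y := by simp [hG]
  rw [hG0] at hF
  rw [eq_inv_mul_iff_mul_eq₀ hpi]
  linear_combination -hF

/-- In the coordinates `(ξ, t)` with `p = (ξ, ξ + t)` the constraint becomes `t > 0`. The inner
integral in `ξ` is a correlation of transforms, and the half-line integral in `t` is the preceding
Cauchy formula. -/
theorem integral_ordered_pair_eq_cauchy (f g : 𝓢(ℝ, ℂ)) {u δ : ℝ} (hδ : 0 < δ)
    (hu : ∀ y, |y - u| < δ → f y * g (-y) = 0) :
    ∫ p : ℝ × ℝ, {p : ℝ × ℝ | p.1 < p.2}.indicator (fun p =>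
        (schwartzHat f p.1 * Complex.exp (2 * Real.pi * Complex.I * u * p.1)) *
        (schwartzHat g p.2 * Complex.exp (2 * Real.pi * Complex.I * (-u : ℝ) * p.2))) p
      = (2 * Real.pi * Complex.I)⁻¹ * ∫ y : ℝ, f y * g (-y) / (u - y) := by
  set K : ℝ × ℝ → ℂ := {p : ℝ × ℝ | p.1 < p.2}.indicator (fun p =>
        (schwartzHat f p.1 * Complex.exp (2 * Real.pi * Complex.I * u * p.1)) *
        (schwartzHat g p.2 * Complex.exp (2 * Real.pi * Complex.I * (-u : ℝ) * p.2))) with hK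
  have hb : ∀ (f : 𝓢(ℝ, ℂ)) (v : ℝ), Integrable (fun ξ : ℝ =>
      schwartzHat f ξ * Complex.exp (2 * Real.pi * Complex.I * v * ξ)) := fun f v => by
    refine (schwartzHat f).integrable.mul_bdd (c := 1) ?_ (Eventually.of_forall fun ξ => ?_)
    · exact (by fun_prop : Continuous fun ξ : ℝ =>
        Complex.exp (2 * Real.pi * Complex.I * v * ξ)).aestronglyMeasurable
    · have : 2 * (Real.pi : ℂ) * Complex.I * v * ξ
        = ((2 * Real.pi * v * ξ : ℝ) : ℂ) * Complex.I := by push_cast; ring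
      rw [this, Complex.norm_exp_ofReal_mul_I]
  have hmeas : MeasurableSet {p : ℝ × ℝ | p.1 < p.2} := measurableSet_lt measurable_fst measurable_snd
  have hKi : Integrable K := ((hb f u).mul_prod (hb g (-u))).indicator hmeas
  have hmp := measurePreserving_prod_add (volume : Measure ℝ) (volume : Measure ℝ)
  have hKi' : Integrable (fun p : ℝ × ℝ => K (p.1, p.1 + p.2)) :=
    hmp.integrable_comp_of_integrable hKi
  have hKe : ∀ ξ t : ℝ, K (ξ, ξ + t) = (Set.Ioi (0 : ℝ)).indicator (fun t : ℝ =>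
      Complex.exp (-(2 * Real.pi * Complex.I * u * t)) *
        (schwartzHat f ξ * schwartzHat g (ξ + t))) t := fun ξ t => by
    rw [hK]
    by_cases ht : 0 < t
    · rw [Set.indicator_of_mem (by simpa using ht), Set.indicator_of_mem (by simpa using ht)]
      have : Complex.exp (-(2 * Real.pi * Complex.I * u * t))
        = Complex.exp (2 * Real.pi * Complex.I * u * ξ) *
          Complex.exp (2 * Real.pi * Complex.I * (-u : ℝ) * (ξ + t : ℝ)) := by
        rw [← Complex.exp_add]
        congr 1
        push_cast
        ring
      rw [this]
      ring
    · rw [Set.indicator_of_notMem (by simpa using ht), Set.indicator_of_notMem (by simpa using ht)]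
  have hinner : ∀ t : ℝ, ∫ ξ, K (ξ, ξ + t) = (Set.Ioi (0 : ℝ)).indicator (fun t : ℝ =>
      ∫ y : ℝ, (f y * g (-y)) * Complex.exp (2 * Real.pi * Complex.I * (y - u) * t)) t := fun t => by
    simp only [hKe]
    by_cases ht : t ∈ Set.Ioi (0 : ℝ)
    · simp only [Set.indicator_of_mem ht]
      rw [integral_const_mul, integral_schwartzHat_mul_schwartzHat_add, ← integral_const_mul]
      refine integral_congr_ae (Eventually.of_forall fun y => ?_)
      simp only
      rw [mul_left_comm, ← Complex.exp_add]
      congr 2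
      ring
    · simp only [Set.indicator_of_notMem ht, integral_zero]
  have h1 : ∫ p, K p = ∫ t, ∫ ξ, K (ξ, ξ + t) := by
    have e : ∫ p : ℝ × ℝ, K (p.1, p.1 + p.2) = ∫ p, K p :=
      hmp.integral_comp (MeasurableEquiv.shearAddRight ℝ).measurableEmbedding K
    rw [← e]
    exact integral_prod_symm _ hKi'
  have hi : Integrable (fun t : ℝ => ∫ ξ, K (ξ, ξ + t)) := hKi'.integral_prod_right
  rw [h1]
  simp only [hinner] at hi ⊢
  rw [integral_indicator measurableSet_Ioi]
  refine integral_Ioi_fourier_eq_cauchy ?_ hδ hu ((integrable_indicator_iff measurableSet_Ioi).1 hi)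
  refine f.integrable.mul_bdd (c := (SchwartzMap.seminorm ℝ 0 0) g) ?_
    (Eventually.of_forall fun y => g.norm_le_seminorm ℝ _)
  exact (g.continuous.comp continuous_neg).aestronglyMeasurable

/-- Fubini after separating the coordinates `a`, `b` from the others; this isolates the only two
coordinates coupled by the constraint. -/
theorem integral_pi_mul_pair {n : ℕ} {a b : Fin n} (hab : a ≠ b) (H : ℝ × ℝ → ℂ)
    (F : Fin n → ℝ → ℂ) :
    ∫ ξ : Fin n → ℝ, H (ξ a, ξ b) * ∏ j ∈ Finset.univ.filter (fun j => ¬(j = a ∨ j = b)), F j (ξ j)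
      = (∫ p, H p) * ∏ j ∈ Finset.univ.filter (fun j => ¬(j = a ∨ j = b)), ∫ ξ, F j ξ := by
  set P : Fin n → Prop := fun j => j = a ∨ j = b with hP
  have ha : P a := Or.inl rfl
  have hb : P b := Or.inr rfl
  let e : Fin 2 ≃ {j // P j} :=
    { toFun := ![⟨a, ha⟩, ⟨b, hb⟩]
      invFun := fun j => if j.1 = a then 0 else 1
      left_inv := fun i => by
        fin_cases i <;> simp [hab.symm]
      right_inv := fun j => by
        obtain ⟨j, rfl | rfl⟩ := j
        · simp
        · simp [hab.symm] }
  have m1 := volume_preserving_piEquivPiSubtypeProd (fun _ : Fin n => ℝ) P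
  have m2 := volume_measurePreserving_piCongrLeft (fun _ : {j // P j} => ℝ) e
  have m3 := volume_preserving_finTwoArrow ℝ
  have h1 : ∫ q : ({j // P j} → ℝ) × ({j // ¬ P j} → ℝ),
      H (q.1 ⟨a, ha⟩, q.1 ⟨b, hb⟩) * ∏ j : {j // ¬ P j}, F j (q.2 j)
      = (∫ v : {j // P j} → ℝ, H (v ⟨a, ha⟩, v ⟨b, hb⟩)) *
        ∏ j : {j // ¬ P j}, ∫ ξ, F j ξ := by
    rw [← integral_fintype_prod_volume_eq_prod (fun (j : {j // ¬ P j}) ξ => F j ξ)]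
    exact integral_prod_mul (fun v : {j // P j} → ℝ => H (v ⟨a, ha⟩, v ⟨b, hb⟩))
      (fun w : {j // ¬ P j} → ℝ => ∏ j : {j // ¬ P j}, F j (w j))
  have h2 : ∫ v : {j // P j} → ℝ, H (v ⟨a, ha⟩, v ⟨b, hb⟩) = ∫ p, H p := by
    rw [← m2.integral_comp (MeasurableEquiv.measurableEmbedding _),
      ← m3.integral_comp (MeasurableEquiv.measurableEmbedding _)]
    refine integral_congr_ae (Eventually.of_forall fun v => ?_)
    have e0 : (MeasurableEquiv.piCongrLeft (fun _ : {j // P j} => ℝ) e) v ⟨a, ha⟩ = v 0 :=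
      Equiv.piCongrLeft_apply_apply (fun _ : {j // P j} => ℝ) e v 0
    have e1 : (MeasurableEquiv.piCongrLeft (fun _ : {j // P j} => ℝ) e) v ⟨b, hb⟩ = v 1 :=
      Equiv.piCongrLeft_apply_apply (fun _ : {j // P j} => ℝ) e v 1
    simp only [e0, e1]
    rfl
  have hprod : ∀ q : Fin n → ℂ, ∏ j ∈ Finset.univ.filter (fun j => ¬ P j), q j
      = ∏ j : {j // ¬ P j}, q j := fun q =>
    Finset.prod_subtype _ (fun j => by simp) q
  rw [hprod, ← h2, ← h1, ← m1.integral_comp (MeasurableEquiv.measurableEmbedding _)]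
  refine integral_congr_ae (Eventually.of_forall fun ξ => ?_)
  simp only
  rw [hprod]
  rfl

/-- A single order constraint factors the operator. -/
theorem sectorOp_pair_eq_mul {n : ℕ} (ε : Fin n → ℤˣ) {a b : Fin n} (hab : a ≠ b) (hε : ε b = -ε a)
    (f : Fin n → 𝓢(ℝ, ℂ)) (x : ℝ) :
    sectorOp {ξ | ξ a < ξ b} ε (fun i => ⇑(f i)) x
      = (∫ p : ℝ × ℝ, {p : ℝ × ℝ | p.1 < p.2}.indicator (fun p =>
          (schwartzHat (f a) p.1 *
            Complex.exp (2 * Real.pi * Complex.I * (((ε a : ℤ) : ℝ) * x : ℝ) * p.1)) *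
          (schwartzHat (f b) p.2 *
            Complex.exp (2 * Real.pi * Complex.I * (-(((ε a : ℤ) : ℝ) * x) : ℝ) * p.2))) p) *
        ∏ j ∈ Finset.univ.filter (fun j => ¬(j = a ∨ j = b)), f j (((ε j : ℤ) : ℝ) * x) := by
  have hb : ((ε b : ℤ) : ℝ) * x = -(((ε a : ℤ) : ℝ) * x) := by simp [hε]
  have hprod : ∀ j, f j (((ε j : ℤ) : ℝ) * x) = ∫ ξ : ℝ, schwartzHat (f j) ξ *
      Complex.exp (2 * Real.pi * Complex.I * (((ε j : ℤ) : ℝ) * x : ℝ) * ξ) := fun j =>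
    (integral_schwartzHat_mul_exp _ _).symm
  simp only [hprod]
  rw [← integral_pi_mul_pair hab, sectorOp_eq, ← integral_indicator
    (measurableSet_lt (measurable_pi_apply a) (measurable_pi_apply b))]
  refine integral_congr_ae (Eventually.of_forall fun ξ => ?_)
  have hsplit : ∀ q : Fin n → ℂ, ∏ j, q j
      = (q a * q b) * ∏ j ∈ Finset.univ.filter (fun j => ¬(j = a ∨ j = b)), q j := fun q => by
    rw [← Finset.prod_filter_mul_prod_filter_not Finset.univ (fun j => j = a ∨ j = b)]
    congr 1
    rw [Finset.filter_or, Finset.filter_eq', Finset.filter_eq']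
    simp only [Finset.mem_univ, if_true]
    rw [Finset.prod_union (by simpa using hab)]
    simp
  beta_reduce
  by_cases h : ξ a < ξ b
  · rw [Set.indicator_of_mem (by simpa using h), Set.indicator_of_mem (by simpa using h),
      signedWave_eq_prod, ← Finset.prod_mul_distrib, hsplit, hb]
  · rw [Set.indicator_of_notMem (by simpa using h), Set.indicator_of_notMem (by simpa using h)]
    simp

/-- A single degenerate order constraint turns the operator into a Cauchy integral of a product. -/
theorem sectorOp_pair {n : ℕ} (ε : Fin n → ℤˣ) {a b : Fin n} (hab : a ≠ b) (hε : ε b = -ε a)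
    (f : Fin n → 𝓢(ℝ, ℂ)) {x δ : ℝ} (hδ : 0 < δ)
    (hu : ∀ y, |y - ((ε a : ℤ) : ℝ) * x| < δ → f a y * f b (-y) = 0) :
    sectorOp {ξ | ξ a < ξ b} ε (fun i => ⇑(f i)) x
      = ((2 * Real.pi * Complex.I)⁻¹ *
          ∫ y : ℝ, f a y * f b (-y) / ((((ε a : ℤ) : ℝ) * x : ℝ) - y)) *
        ∏ j ∈ Finset.univ.filter (fun j => ¬(j = a ∨ j = b)), f j (((ε j : ℤ) : ℝ) * x) := by
  rw [sectorOp_pair_eq_mul ε hab hε, integral_ordered_pair_eq_cauchy (f a) (f b) hδ hu]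

/-! ### Limits of the frequency region under large translations. -/

/-- For each pair the term of size `M` decides unless `c i = c j`, in which case the translation
cancels; finitely many pairs share a threshold. -/
theorem eventually_strictMono_add_smul_iff {n : ℕ} (c ξ : Fin n → ℝ) :
    ∀ᶠ M : ℕ in atTop, (StrictMono (ξ + (M : ℝ) • c) ↔
      ∀ i j, i < j → (c i < c j ∨ (c i = c j ∧ ξ i < ξ j))) := by
  have h : ∀ i j : Fin n, ∀ᶠ M : ℕ in atTop,
      (ξ i + M * c i < ξ j + M * c j ↔ (c i < c j ∨ (c i = c j ∧ ξ i < ξ j))) := fun i j => by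
    rcases lt_trichotomy (c i) (c j) with hc | hc | hc
    · have ht : Tendsto (fun M : ℕ => (M : ℝ) * (c j - c i)) atTop atTop :=
        tendsto_natCast_atTop_atTop.atTop_mul_const (sub_pos.2 hc)
      filter_upwards [ht.eventually_gt_atTop (ξ i - ξ j)] with M hM
      simp only [hc, true_or, iff_true]
      linarith
    · exact Eventually.of_forall fun M => by simp [hc]
    · have ht : Tendsto (fun M : ℕ => (M : ℝ) * (c i - c j)) atTop atTop :=
        tendsto_natCast_atTop_atTop.atTop_mul_const (sub_pos.2 hc)
      filter_upwards [ht.eventually_ge_atTop (ξ j - ξ i)] with M hM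
      simp only [hc.not_gt, hc.ne', false_and, or_self, iff_false, not_lt]
      linarith
  have h2 : ∀ᶠ M : ℕ in atTop, ∀ i j : Fin n,
      (ξ i + M * c i < ξ j + M * c j ↔ (c i < c j ∨ (c i = c j ∧ ξ i < ξ j))) :=
    eventually_all.2 fun i => eventually_all.2 fun j => h i j
  filter_upwards [h2] with M hM
  simp only [StrictMono, Pi.add_apply, Pi.smul_apply, smul_eq_mul, hM]

/-- The frequency region that survives when the `i`-th frequency is translated by a large multiple
of `c i`. -/
def limitSector {n : ℕ} (c : Fin n → ℝ) : Set (Fin n → ℝ) :=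
  {ξ | ∀ i j, i < j → (c i < c j ∨ (c i = c j ∧ ξ i < ξ j))}

theorem measurableSet_limitSector {n : ℕ} (c : Fin n → ℝ) : MeasurableSet (limitSector c) := by
  have : limitSector c = ⋂ i, ⋂ j, ⋂ (_ : i < j),
      {ξ | c i < c j ∨ (c i = c j ∧ ξ i < ξ j)} := by
    ext ξ
    simp [limitSector]
  rw [this]
  refine MeasurableSet.iInter fun i => MeasurableSet.iInter fun j => MeasurableSet.iInter fun _ => ?_
  exact (MeasurableSet.const _).union ((MeasurableSet.const _).inter
    (measurableSet_lt (measurable_pi_apply i) (measurable_pi_apply j)))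

theorem limitSector_of_strictMono {n : ℕ} {c : Fin n → ℝ} (hc : StrictMono c) :
    limitSector c = Set.univ :=
  Set.eq_univ_of_forall fun _ _ _ hij => Or.inl (hc hij)

theorem limitSector_of_not_monotone {n : ℕ} {c : Fin n → ℝ} {i j : Fin n} (hij : i < j)
    (hc : c j < c i) : limitSector c = ∅ := by
  refine Set.eq_empty_of_forall_notMem fun ξ h => ?_
  rcases h i j hij with h | h
  · exact h.not_gt hc
  · exact hc.ne h.1.symm

theorem limitSector_pair {n : ℕ} {c : Fin n → ℝ} {a b : Fin n} (hab : a < b) (heq : c a = c b)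
    (hc : ∀ i j, i < j → (c i < c j ∨ (i = a ∧ j = b))) :
    limitSector c = {ξ | ξ a < ξ b} := by
  ext ξ
  constructor
  · intro h
    rcases h a b hab with h | h
    · exact absurd heq h.ne
    · exact h.2
  · intro h i j hij
    rcases hc i j hij with h' | ⟨rfl, rfl⟩
    · exact Or.inl h'
    · exact Or.inr ⟨heq, h⟩

theorem eventually_norm_orderedOscOp_modulate_sub_le {n : ℕ} (ε : Fin n → ℤˣ)
    (f : Fin n → 𝓢(ℝ, ℂ)) (c : Fin n → ℝ) {η : ℝ} (hη : 0 < η) :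
    ∀ᶠ M : ℕ in atTop, ∀ x,
      ‖orderedOscOp ε (fun i => ⇑(modulate (M * c i) (f i))) x
        - signedWave ε x ((M : ℝ) • c) * sectorOp (limitSector c) ε (fun i => ⇑(f i)) x‖ ≤ η := by
  have h := eventually_norm_sectorOp_sub_le ε f
    (S := fun M : ℕ => {ξ | StrictMono (ξ + (M : ℝ) • c)}) (T := limitSector c)
    (fun M => (measurable_id.add_const _) measurableSet_strictMono) (measurableSet_limitSector c)
    (fun ξ => eventually_strictMono_add_smul_iff c ξ) hη
  filter_upwards [h] with M hM x
  have e : orderedOscOp ε (fun i => ⇑(modulate (M * c i) (f i))) x = _ :=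
    orderedOscOp_modulate ε f ((M : ℝ) • c) x
  rw [e, ← mul_sub, norm_mul, norm_signedWave, one_mul]
  exact hM x

/-! ### Behaviour of the factor norms under modulation and dilation. -/

namespace FactorSpace

theorem one_le_exponent {X : FactorSpace} (hX : X.Admissible) : 1 ≤ X.exponent := by
  cases X with
  | lebesgue p => exact hX.1.le
  | wiener p => exact hX.1

theorem norm_modulate (X : FactorSpace) (a : ℝ) (f : 𝓢(ℝ, ℂ)) :
    X.norm (modulate a f) = X.norm f := by
  cases X with
  | lebesgue p => exact eLpNorm_congr_norm_ae (Eventually.of_forall fun y => _root_.norm_modulate a f y)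
  | wiener p =>
    simp only [norm, fourier_coe_eq_schwartzHat]
    have : ⇑(schwartzHat (modulate a f)) = ⇑(schwartzHat f) ∘ fun ξ => ξ - a :=
      funext fun ξ => schwartzHat_modulate a f ξ
    rw [this]
    exact eLpNorm_comp_measurePreserving (p := p.conjExponent)
      (schwartzHat f).continuous.aestronglyMeasurable (measurePreserving_sub_right volume a)

theorem norm_lt_top (X : FactorSpace) (f : 𝓢(ℝ, ℂ)) : X.norm f < ∞ := by
  cases X with
  | lebesgue p => exact (f.memLp p volume).2
  | wiener p =>
    simp only [norm, fourier_coe_eq_schwartzHat]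
    exact ((schwartzHat f).memLp _ volume).2

end FactorSpace

theorem eLpNorm_comp_mul_left {r : ℝ} (hr : 0 < r) (f : ℝ → ℂ) (p : ℝ≥0∞) :
    eLpNorm (fun y => f (r * y)) p volume
      = ENNReal.ofReal r ^ (-(p⁻¹).toReal) * eLpNorm f p volume := by
  have he : MeasurableEmbedding fun y : ℝ => r * y :=
    (Homeomorph.mulLeft₀ r hr.ne').measurableEmbedding
  have h := he.eLpNorm_map_measure (g := f) (p := p) (μ := volume)
  rw [Real.map_volume_mul_left hr.ne', eLpNorm_smul_measure_of_ne_zero (by simpa using hr.ne')] at h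
  change _ = eLpNorm (fun y => f (r * y)) p volume at h
  rw [← h, smul_eq_mul, abs_of_pos (inv_pos.2 hr), ENNReal.ofReal_inv_of_pos hr, ENNReal.inv_rpow,
    ENNReal.rpow_neg, one_div]

/-- The dilation `y ↦ f (r y)` of a Schwartz function. -/
noncomputable def dilate (r : ℝ) (hr : r ≠ 0) (f : 𝓢(ℝ, ℂ)) : 𝓢(ℝ, ℂ) :=
  SchwartzMap.compCLMOfContinuousLinearEquiv ℂ
    (ContinuousLinearEquiv.unitsEquivAut ℝ (Units.mk0 r hr)) f

theorem dilate_apply (r : ℝ) (hr : r ≠ 0) (f : 𝓢(ℝ, ℂ)) (y : ℝ) :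
    dilate r hr f y = f (r * y) := by
  change f (y * r) = _
  rw [mul_comm]

theorem schwartzHat_dilate {r : ℝ} (hr : 0 < r) (f : 𝓢(ℝ, ℂ)) (ξ : ℝ) :
    schwartzHat (dilate r hr.ne' f) ξ = (r⁻¹ : ℝ) • schwartzHat f (r⁻¹ * ξ) := by
  rw [schwartzHat_apply, schwartzHat_apply]
  have h := Measure.integral_comp_mul_left (fun y : ℝ =>
    Complex.exp (-(2 * Real.pi * Complex.I * y * (r⁻¹ * ξ : ℝ))) * f y) r
  rw [abs_of_pos (inv_pos.2 hr)] at h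
  rw [← h]
  refine integral_congr_ae (Eventually.of_forall fun y => ?_)
  simp only [dilate_apply]
  congr 3
  have : (r : ℂ) ≠ 0 := by exact_mod_cast hr.ne'
  push_cast
  field_simp

namespace FactorSpace

/-- `L^p` and `W_p` scale alike: dilation multiplies the transform by `r⁻¹` and stretches it by `r`,
giving the power `-1 + 1/p' = -1/p`. -/
theorem norm_dilate {X : FactorSpace} (hX : X.Admissible) {r : ℝ} (hr : 0 < r) (f : 𝓢(ℝ, ℂ)) :
    X.norm (dilate r hr.ne' f)
      = ENNReal.ofReal r ^ (-(X.exponent⁻¹).toReal) * X.norm f := by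
  cases X with
  | lebesgue p =>
    simp only [norm, exponent]
    rw [← eLpNorm_comp_mul_left hr]
    congr 1
    exact funext fun y => dilate_apply r hr.ne' f y
  | wiener p =>
    have hp : 1 ≤ p := hX.1
    have : p.HolderConjugate p.conjExponent := ENNReal.HolderConjugate.conjExponent hp
    simp only [norm, exponent, fourier_coe_eq_schwartzHat]
    have e : ⇑(schwartzHat (dilate r hr.ne' f)) = r⁻¹ • fun ξ => schwartzHat f (r⁻¹ * ξ) :=
      funext fun ξ => schwartzHat_dilate hr f ξ
    rw [e, eLpNorm_const_smul, eLpNorm_comp_mul_left (inv_pos.2 hr), ← mul_assoc]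
    congr 1
    have h0 : ENNReal.ofReal r ≠ 0 := by simpa using hr
    have h1 : p⁻¹ + p.conjExponent⁻¹ = 1 := ENNReal.HolderConjugate.inv_add_inv_eq_one p _
    have hp1 : p⁻¹ ≠ ∞ := fun h => by simp [h] at h1
    have hp2 : p.conjExponent⁻¹ ≠ ∞ := fun h => by simp [h] at h1
    have h2 : (p⁻¹).toReal + (p.conjExponent⁻¹).toReal = 1 := by
      rw [← ENNReal.toReal_add hp1 hp2, h1, ENNReal.toReal_one]
    rw [Real.enorm_eq_ofReal (inv_pos.2 hr).le, ENNReal.ofReal_inv_of_pos hr, ENNReal.inv_rpow,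
      ← ENNReal.rpow_neg, neg_neg, ← ENNReal.rpow_neg_one, ← ENNReal.rpow_add _ _ h0 (by simp)]
    congr 1
    linarith

end FactorSpace

/-! ### From pointwise lower bounds to norm inequalities. -/

theorem exponent_sum_inv_ne_zero {n : ℕ} {X : Fin n → FactorSpace} (hX : ∀ i, (X i).Admissible) :
    (∑ i, (X i).exponent⁻¹)⁻¹ ≠ 0 := by
  rw [Ne, ENNReal.inv_eq_zero]
  refine (ENNReal.sum_lt_top.2 fun i _ => ?_).ne
  exact (ENNReal.inv_le_one.2 (FactorSpace.one_le_exponent (hX i))).trans_lt ENNReal.one_lt_top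

/-- Comparison with `δ` times the indicator of `E`. For `q = ∞` the exponent `1 / q.toReal` is `0`,
so the same formula serves. -/
theorem ofReal_mul_volume_rpow_le_eLpNorm {E : Set ℝ} (hE : MeasurableSet E) (h0 : volume E ≠ 0)
    {δ : ℝ} (hδ : 0 ≤ δ) {g : ℝ → ℂ} (hg : ∀ x ∈ E, δ ≤ ‖g x‖) {q : ℝ≥0∞} (hq : q ≠ 0) :
    ENNReal.ofReal δ * volume E ^ (1 / q.toReal) ≤ eLpNorm g q volume := by
  have h := eLpNorm_indicator_const' (c := (δ : ℝ)) hE h0 hq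
  rw [Real.enorm_eq_ofReal hδ] at h
  rw [← h]
  refine eLpNorm_mono fun x => ?_
  by_cases hx : x ∈ E
  · simpa [hx, abs_of_nonneg hδ] using hg x hx
  · simp [hx]

/-- A bump function as a Schwartz function. -/
noncomputable def schwartzBump {c : ℝ} (φ : ContDiffBump c) : 𝓢(ℝ, ℂ) :=
  HasCompactSupport.toSchwartzMap (f := fun x => ((φ x : ℝ) : ℂ))
    (φ.hasCompactSupport.comp_left Complex.ofReal_zero)
    (Complex.ofRealCLM.contDiff.comp φ.contDiff)

theorem schwartzBump_apply {c : ℝ} (φ : ContDiffBump c) (x : ℝ) :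
    schwartzBump φ x = ((φ x : ℝ) : ℂ) := rfl

theorem SignDegenerate.eq_neg {n : ℕ} {ε : Fin n → ℤˣ} {i j : Fin n} (h : SignDegenerate ε i j) :
    ε j = -ε i := by
  apply Units.ext
  rw [Units.val_neg]
  unfold SignDegenerate at h
  linarith

theorem abs_sign_mul {n : ℕ} (ε : Fin n → ℤˣ) (i : Fin n) (x : ℝ) :
    |((ε i : ℤ) : ℝ) * x| = |x| := by
  rcases Int.units_eq_one_or (ε i) with h | h <;> simp [h]

/-- The bump function equal to one on `[-3, 3]`. -/
noncomputable def plateau : 𝓢(ℝ, ℂ) :=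
  schwartzBump (⟨3, 4, by norm_num, by norm_num⟩ : ContDiffBump (0 : ℝ))

theorem plateau_eq_one {x : ℝ} (hx : |x| ≤ 3) : plateau x = 1 := by
  rw [plateau, schwartzBump_apply, ContDiffBump.one_of_mem_closedBall]
  · simp
  · simpa using hx

/-- A lower bound for the output on a set yields a lower bound for the norms of the inputs, after
the inputs are modulated far apart. -/
theorem lower_bound_le_prod_norm {n : ℕ} {ε : Fin n → ℤˣ} {X : Fin n → FactorSpace}
    (hX : ∀ i, (X i).Admissible) {C : ℝ≥0}
    (hC : ∀ f : Fin n → 𝓢(ℝ, ℂ), eLpNorm (orderedOscOp ε fun i => ⇑(f i))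
      (∑ i, (X i).exponent⁻¹)⁻¹ volume ≤ C * ∏ i, (X i).norm (f i))
    (c : Fin n → ℝ) (f : Fin n → 𝓢(ℝ, ℂ)) {E : Set ℝ} (hE : MeasurableSet E)
    (h0 : volume E ≠ 0) {δ : ℝ} (hδ : 0 < δ)
    (h : ∀ x ∈ E, 2 * δ ≤ ‖sectorOp (limitSector c) ε (fun i => ⇑(f i)) x‖) :
    ENNReal.ofReal δ * volume E ^ (1 / ((∑ i, (X i).exponent⁻¹)⁻¹).toReal)
      ≤ C * ∏ i, (X i).norm (f i) := by
  -- The approximation error `δ` uses up half of the assumed lower bound `2 * δ`.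
  obtain ⟨M, hM⟩ := (eventually_norm_orderedOscOp_modulate_sub_le ε f c hδ).exists
  have h1 := hC fun i => modulate (M * c i) (f i)
  simp only [FactorSpace.norm_modulate] at h1
  refine le_trans ?_ h1
  refine ofReal_mul_volume_rpow_le_eLpNorm hE h0 hδ.le (fun x hx => ?_)
    (exponent_sum_inv_ne_zero hX)
  have h2 := norm_sub_norm_le (signedWave ε x ((M : ℝ) • c) *
    sectorOp (limitSector c) ε (fun i => ⇑(f i)) x)
    (orderedOscOp ε (fun i => ⇑(modulate (M * c i) (f i))) x)
  rw [norm_mul, norm_signedWave, one_mul, norm_sub_rev] at h2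
  linarith [h x hx, hM x]

/-- The Cauchy integral of a nonnegative bump supported on one side of `u`. -/
theorem exists_cauchy_integral_eq {h : ℝ → ℝ} (hi : Integrable h) (h0 : ∀ y, 0 ≤ h y)
    {s u δ D c r : ℝ} (hs : s = 1 ∨ s = -1) (hδ : 0 < δ) (hD : 0 < D) (hr : 0 ≤ r)
    (hu : ∀ y, h y ≠ 0 → δ ≤ s * (u - y) ∧ s * (u - y) ≤ D)
    (h1 : ∀ y, |y - c| ≤ r → h y = 1) :
    ∃ I : ℝ, ∫ y : ℝ, (h y : ℂ) / (u - y) = (s * I : ℝ) ∧ 2 * r / D ≤ I := by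
  have hss : s * s = 1 := by rcases hs with rfl | rfl <;> norm_num
  have hinv : ∀ y, h y / (u - y) = s * (h y / (s * (u - y))) := fun y => by
    rcases hs with rfl | rfl
    · simp
    · rw [neg_one_mul, neg_one_mul, div_neg, neg_neg]
  have hlow : ∀ y, D⁻¹ * h y ≤ h y / (s * (u - y)) := fun y => by
    by_cases hy : h y = 0
    · simp [hy]
    · obtain ⟨ha, hb⟩ := hu y hy
      rw [div_eq_inv_mul]
      exact mul_le_mul_of_nonneg_right (inv_anti₀ (hδ.trans_le ha) hb) (h0 y)
  have hup : ∀ y, h y / (s * (u - y)) ≤ δ⁻¹ * h y := fun y => by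
    by_cases hy : h y = 0
    · simp [hy]
    · obtain ⟨ha, hb⟩ := hu y hy
      rw [div_eq_inv_mul]
      exact mul_le_mul_of_nonneg_right (inv_anti₀ hδ ha) (h0 y)
  have hJ : Integrable (fun y => h y / (s * (u - y))) := by
    refine (hi.const_mul δ⁻¹).mono' ?_ (Eventually.of_forall fun y => ?_)
    · exact (hi.aestronglyMeasurable.aemeasurable.div
        (by fun_prop : Measurable fun y : ℝ => s * (u - y)).aemeasurable).aestronglyMeasurable
    · rw [Real.norm_of_nonneg ((mul_nonneg (inv_nonneg.2 hD.le) (h0 y)).trans (hlow y))]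
      exact hup y
  refine ⟨∫ y, h y / (s * (u - y)), ?_, ?_⟩
  · rw [← integral_const_mul, ← integral_complex_ofReal]
    refine integral_congr_ae (Eventually.of_forall fun y => ?_)
    simp only
    rw [← hinv]
    push_cast
    rfl
  · have h2 : 2 * r ≤ ∫ y, h y := by
      have h3 := setIntegral_le_integral (s := Metric.closedBall c r) hi (Eventually.of_forall h0)
      have h4 : ∫ y in Metric.closedBall c r, h y = ∫ y in Metric.closedBall c r, (1 : ℝ) := by
        refine setIntegral_congr_fun Metric.isClosed_closedBall.measurableSet fun y hy => ?_
        exact h1 y (by simpa [Real.dist_eq] using hy)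
      rw [h4, setIntegral_const, smul_eq_mul, mul_one, Real.volume_real_closedBall hr] at h3
      exact h3
    have h5 : ∫ y, D⁻¹ * h y ≤ ∫ y, h y / (s * (u - y)) :=
      integral_mono (hi.const_mul _) hJ hlow
    rw [integral_const_mul] at h5
    refine le_trans ?_ h5
    rw [div_eq_inv_mul]
    gcongr

theorem norm_two_pi_I_inv_mul_ofReal (I : ℝ) :
    ‖(2 * Real.pi * Complex.I : ℂ)⁻¹ * (I : ℂ)‖ = |I| / (2 * Real.pi) := by
  rw [norm_mul, norm_inv, norm_mul, norm_mul, Complex.norm_I, Complex.norm_real, Complex.norm_real,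
    Real.norm_of_nonneg Real.pi_pos.le, Complex.norm_ofNat, Real.norm_eq_abs]
  field_simp

/-! ### The condition on neighbouring exponents. -/

/-- The bump function equal to one on `[-1/4, 1/4]` and supported in `[-1/2, 1/2]`. -/
noncomputable def unitBumpFun : ContDiffBump (0 : ℝ) := ⟨1 / 4, 1 / 2, by norm_num, by norm_num⟩

/-- Necessity of the strict condition on neighbouring exponents, up to equality. -/
theorem exponent_inv_add_exponent_inv_le_one {n : ℕ} {ε : Fin n → ℤˣ} {X : Fin n → FactorSpace}
    (hX : ∀ i, (X i).Admissible) (hbdd : IsMixedBounded ε X) {i j : Fin n}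
    (hij : (j : ℕ) = i + 1) (hε : SignDegenerate ε i j) :
    ((X i).exponent⁻¹).toReal + ((X j).exponent⁻¹).toReal ≤ 1 := by
  obtain ⟨C, hC⟩ := hbdd
  have hlt : i < j := by rw [Fin.lt_def]; omega
  set φ := unitBumpFun with hφ
  set F₀ : Fin n → 𝓢(ℝ, ℂ) := fun k => if k = i ∨ k = j then schwartzBump φ else plateau with hF₀
  -- Strictly increasing except for a single tie, between `i` and `j = i + 1`, so exactly one
  -- constraint survives.
  set c : Fin n → ℝ := fun k => if k ≤ i then (k : ℝ) else (k : ℝ) - 1 with hc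
  have hsec : limitSector c = {ξ | ξ i < ξ j} := by
    refine limitSector_pair hlt ?_ fun k l hkl => ?_
    · simp [hc, hlt, hij]
    · have hkl' : (k : ℕ) < l := hkl
      by_cases hk : k ≤ i <;> by_cases hl : l ≤ i
      · left
        simp only [hc, hk, hl, if_true]
        exact_mod_cast hkl'
      · by_cases h : k = i ∧ l = j
        · exact Or.inr h
        · left
          simp only [hc, hk, hl, if_true, if_false]
          have h1 : (k : ℕ) + 1 < l := by
            rw [Fin.le_def] at hk hl
            rw [Fin.ext_iff, Fin.ext_iff] at h
            omega
          have : (k : ℝ) + 1 < l := by exact_mod_cast h1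
          linarith
      · exact absurd (hkl.le.trans hl) hk
      · left
        simp only [hc, hk, hl, if_false]
        have : (k : ℝ) < l := by exact_mod_cast hkl'
        linarith
  set s := ((X i).exponent⁻¹).toReal + ((X j).exponent⁻¹).toReal with hs
  set K : ℝ≥0∞ := C * ∏ k, (X k).norm (F₀ k) with hK
  have hKt : K ≠ ∞ := ENNReal.mul_ne_top (by simp)
    (ENNReal.prod_lt_top fun k _ => (X k).norm_lt_top _).ne
  -- The product of bumps is one on an interval of length `1/(2R)` and lies within distance `3` of
  -- the base point, so the Cauchy integral is at least `1/(6R)`. Dividing by `2π ≤ 8` and halving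
  -- for the approximation leaves `1/(96R)`.
  have key : ∀ R : ℝ, 1 ≤ R → R ^ (s - 1) ≤ 96 * K.toReal := fun R hR => by
    have hR0 : 0 < R := by linarith
    set F : Fin n → 𝓢(ℝ, ℂ) := fun k =>
      if k = i ∨ k = j then dilate R hR0.ne' (schwartzBump φ) else plateau with hF
    have hFi : F i = dilate R hR0.ne' (schwartzBump φ) := by simp [hF]
    have hFj : F j = dilate R hR0.ne' (schwartzBump φ) := by simp [hF]
    have hFij : ∀ y : ℝ, F i y * F j (-y) = ((φ (R * y) * φ (R * -y) : ℝ) : ℂ) := fun y => by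
      rw [hFi, hFj, dilate_apply, dilate_apply, schwartzBump_apply, schwartzBump_apply]
      push_cast
      rfl
    have hsupp : ∀ y : ℝ, φ (R * y) * φ (R * -y) ≠ 0 → |y| ≤ 1 / 2 := fun y hy => by
      by_contra hcon
      push Not at hcon
      apply hy
      rw [ContDiffBump.zero_of_le_dist, zero_mul]
      rw [Real.dist_eq, sub_zero, abs_mul, abs_of_pos hR0]
      change 1 / 2 ≤ _
      nlinarith
    have hεi : ((ε i : ℤ) : ℝ) = 1 ∨ ((ε i : ℤ) : ℝ) = -1 := by
      rcases Int.units_eq_one_or (ε i) with h | h <;> simp [h]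
    have hlow : ∀ x ∈ Set.Icc (1 : ℝ) 2,
        2 * (1 / (96 * R)) ≤ ‖sectorOp (limitSector c) ε (fun k => ⇑(F k)) x‖ := fun x hx => by
      rw [hsec, sectorOp_pair ε hlt.ne hε.eq_neg F (δ := 1 / 4) (by norm_num)]
      · have hothers : ∏ k ∈ Finset.univ.filter (fun k => ¬(k = i ∨ k = j)),
            F k (((ε k : ℤ) : ℝ) * x) = 1 := by
          refine Finset.prod_eq_one fun k hk => ?_
          have hk' : ¬(k = i ∨ k = j) := by simpa using hk
          simp only [hF, hk', if_false]
          refine plateau_eq_one ?_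
          rw [abs_sign_mul, abs_of_nonneg (by linarith [hx.1])]
          linarith [hx.2]
        rw [hothers, mul_one]
        simp only [hFij]
        have hcont : Continuous fun y : ℝ => φ (R * y) * φ (R * -y) :=
          (φ.continuous.comp (by fun_prop)).mul (φ.continuous.comp (by fun_prop))
        have hcs : HasCompactSupport fun y : ℝ => φ (R * y) * φ (R * -y) :=
          HasCompactSupport.of_support_subset_isCompact
            (isCompact_Icc (a := -(1 / 2 : ℝ)) (b := 1 / 2)) fun y hy => abs_le.1 (hsupp y hy)
        obtain ⟨I, hI, hI2⟩ := exists_cauchy_integral_eq (hcont.integrable_of_hasCompactSupport hcs)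
          (fun y => mul_nonneg φ.nonneg φ.nonneg) (u := ((ε i : ℤ) : ℝ) * x) (δ := 1 / 2) (D := 3)
          (c := 0) (r := 1 / (4 * R)) hεi (by norm_num) (by norm_num) (by positivity)
          (fun y hy => by
            have hy' := abs_le.1 (hsupp y hy)
            rcases hεi with h | h <;> rw [h] <;> constructor <;>
              linarith [hx.1, hx.2, hy'.1, hy'.2])
          (fun y hy => by
            rw [sub_zero, le_div_iff₀ (by positivity)] at hy
            have h4 : |R * y| ≤ 1 / 4 := by rw [abs_mul, abs_of_pos hR0]; linarith
            rw [ContDiffBump.one_of_mem_closedBall, ContDiffBump.one_of_mem_closedBall, one_mul]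
            · rw [mul_neg, Metric.mem_closedBall, Real.dist_eq, sub_zero, abs_neg]
              exact h4
            · rw [Metric.mem_closedBall, Real.dist_eq, sub_zero]
              exact h4)
        rw [hI, norm_two_pi_I_inv_mul_ofReal, abs_sign_mul, le_div_iff₀ (by positivity)]
        refine le_trans ?_ (hI2.trans (le_abs_self I))
        have hpi : Real.pi ≤ 4 := Real.pi_le_four
        have : 2 * (1 / (96 * R)) * (2 * Real.pi) = Real.pi * (1 / (24 * R)) := by
          field_simp; norm_num
        rw [this]
        have h6 : 2 * (1 / (4 * R)) / 3 = 4 * (1 / (24 * R)) := by field_simp; norm_num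
        rw [h6]
        gcongr
      · intro y hy
        rw [hFij]
        by_contra hcon
        have hne : φ (R * y) * φ (R * -y) ≠ 0 := fun h => hcon (by rw [h]; simp)
        have h1 := hsupp y hne
        have h2 : |((ε i : ℤ) : ℝ) * x| ≤ |y| + |y - ((ε i : ℤ) : ℝ) * x| := by
          have := abs_sub_abs_le_abs_sub (((ε i : ℤ) : ℝ) * x) y
          rw [abs_sub_comm] at this
          linarith
        rw [abs_sign_mul, abs_of_nonneg (by linarith [hx.1])] at h2
        linarith [hx.1]
    have hfin := lower_bound_le_prod_norm hX hC c F measurableSet_Icc (by simp) (by positivity) hlow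
    have hprod : ∏ k, (X k).norm (F k) = ENNReal.ofReal R ^ (-s) * ∏ k, (X k).norm (F₀ k) := by
      have h1 : ∀ k, (X k).norm (F k) = (if k = i ∨ k = j then
          ENNReal.ofReal R ^ (-((X k).exponent⁻¹).toReal) else 1) * (X k).norm (F₀ k) := fun k => by
        simp only [hF, hF₀]
        split_ifs
        · exact FactorSpace.norm_dilate (hX k) hR0 _
        · rw [one_mul]
      rw [Finset.prod_congr rfl fun k _ => h1 k, Finset.prod_mul_distrib]
      congr 1
      rw [← Finset.prod_filter, Finset.filter_or, Finset.filter_eq', Finset.filter_eq']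
      simp only [Finset.mem_univ, if_true]
      rw [Finset.prod_union (by simpa using hlt.ne)]
      simp only [Finset.prod_singleton]
      rw [← ENNReal.rpow_add _ _ (by simpa using hR0) (by simp)]
      congr 1
      rw [hs]
      ring
    rw [hprod, mul_left_comm, ← hK, Real.volume_Icc, ENNReal.ofReal_rpow_of_pos hR0,
      ← ENNReal.ofReal_toReal hKt, ← ENNReal.ofReal_mul (by positivity)] at hfin
    norm_num at hfin
    rw [ENNReal.ofReal_le_ofReal_iff (by positivity)] at hfin
    rw [Real.rpow_sub hR0, Real.rpow_one, div_le_iff₀ hR0]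
    rw [Real.rpow_neg hR0.le] at hfin
    have hRs : 0 < R ^ s := Real.rpow_pos_of_pos hR0 s
    field_simp at hfin
    linarith
  by_contra hcon
  push Not at hcon
  have ht := tendsto_rpow_atTop (sub_pos.2 hcon)
  obtain ⟨R, hR1, hR2⟩ := ((eventually_ge_atTop (1 : ℝ)).and
    (ht.eventually_gt_atTop (96 * K.toReal))).exists
  exact absurd (key R hR1) (not_le.2 hR2)

/-! ### Wiener exponents and Gaussian chirps. -/

theorem ENNReal.two_lt_conjExponent {p : ℝ≥0∞} (h1 : 1 ≤ p) (h2 : p < 2) :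
    2 < p.conjExponent := by
  have : p.HolderConjugate p.conjExponent := ENNReal.HolderConjugate.conjExponent h1
  have h := ENNReal.HolderConjugate.inv_add_inv_eq_one p p.conjExponent
  by_contra hcon
  push Not at hcon
  have ha : (2 : ℝ≥0∞)⁻¹ < p⁻¹ := ENNReal.inv_lt_inv.2 h2
  have hb : (2 : ℝ≥0∞)⁻¹ ≤ p.conjExponent⁻¹ := ENNReal.inv_le_inv.2 hcon
  have hc := ENNReal.add_lt_add_of_lt_of_le (by simp) ha hb
  rw [h, ENNReal.inv_two_add_inv_two] at hc
  exact lt_irrefl _ hc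

/-- Functions bounded in `L²` and uniformly small are small in `L^q` for `q > 2`. -/
theorem exists_eLpNorm_le_of_norm_le {q : ℝ≥0∞} (hq : 2 < q) {K : ℝ} (hK : 0 ≤ K) {η : ℝ}
    (hη : 0 < η) :
    ∃ A : ℝ, 0 < A ∧ ∀ g : ℝ → ℂ, (∀ x, ‖g x‖ ≤ A) → Integrable (fun x => ‖g x‖ ^ 2) →
      ∫ x, ‖g x‖ ^ 2 ≤ K → eLpNorm g q volume ≤ ENNReal.ofReal η := by
  rcases eq_or_ne q ∞ with rfl | hqt
  · refine ⟨η, hη, fun g hg _ _ => ?_⟩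
    rw [eLpNorm_exponent_top]
    refine eLpNormEssSup_le_of_ae_enorm_bound (Eventually.of_forall fun x => ?_)
    rw [← ofReal_norm]
    exact ENNReal.ofReal_le_ofReal (hg x)
  set r := q.toReal with hr
  have hr2 : 2 < r := by
    have := (ENNReal.toReal_lt_toReal (by simp) hqt).2 hq
    simpa using this
  have hA : 0 < η ^ r / (K + 1) := by positivity
  -- Chosen so that `A ^ (r - 2) * K ≤ η ^ r`; the `+ 1` covers `K = 0`.
  refine ⟨(η ^ r / (K + 1)) ^ (r - 2)⁻¹, by positivity, fun g hg hi hgK => ?_⟩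
  set A := (η ^ r / (K + 1)) ^ (r - 2)⁻¹ with hAdef
  have hApos : 0 < A := by positivity
  have hAr : A ^ (r - 2) = η ^ r / (K + 1) := by
    rw [hAdef, ← Real.rpow_mul hA.le, inv_mul_cancel₀ (by linarith), Real.rpow_one]
  have hq0 : q ≠ 0 := (lt_trans (by simp) hq).ne'
  rw [eLpNorm_eq_lintegral_rpow_enorm_toReal hq0 hqt, ← hr, one_div,
    ENNReal.rpow_inv_le_iff (by linarith)]
  have hpt : ∀ x, ‖g x‖ₑ ^ r ≤ ENNReal.ofReal (A ^ (r - 2) * ‖g x‖ ^ 2) := fun x => by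
    rw [← ofReal_norm, ENNReal.ofReal_rpow_of_nonneg (norm_nonneg _) (by linarith)]
    refine ENNReal.ofReal_le_ofReal ?_
    rcases (norm_nonneg (g x)).eq_or_lt with h0 | h0
    · rw [← h0, Real.zero_rpow (by linarith)]
      simp
    · have : ‖g x‖ ^ r = ‖g x‖ ^ (r - 2) * ‖g x‖ ^ 2 := by
        rw [← Real.rpow_natCast, ← Real.rpow_add h0]
        congr 1
        push_cast
        ring
      rw [this]
      gcongr
      exact hg x
  calc ∫⁻ x, ‖g x‖ₑ ^ r ≤ ∫⁻ x, ENNReal.ofReal (A ^ (r - 2) * ‖g x‖ ^ 2) := lintegral_mono hpt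
    _ = ENNReal.ofReal (∫ x, A ^ (r - 2) * ‖g x‖ ^ 2) :=
        (ofReal_integral_eq_lintegral_ofReal (hi.const_mul _)
          (Eventually.of_forall fun x => by positivity)).symm
    _ ≤ ENNReal.ofReal (η ^ r) := by
        refine ENNReal.ofReal_le_ofReal ?_
        rw [integral_const_mul, hAr, div_mul_eq_mul_div, div_le_iff₀ (by linarith)]
        gcongr
        linarith
    _ = ENNReal.ofReal η ^ r := (ENNReal.ofReal_rpow_of_pos hη).symm

theorem hasCompactSupport_plateau : HasCompactSupport (plateau : ℝ → ℂ) := by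
  have h := ContDiffBump.hasCompactSupport
    (⟨3, 4, by norm_num, by norm_num⟩ : ContDiffBump (0 : ℝ))
  exact h.comp_left Complex.ofReal_zero

theorem contDiff_gaussian_mul (b : ℂ) (f : 𝓢(ℝ, ℂ)) :
    ContDiff ℝ ((⊤ : ℕ∞) : WithTop ℕ∞) fun y : ℝ => Complex.exp (-Real.pi * b * y ^ 2) * f y := by
  have h1 : ContDiff ℝ ((⊤ : ℕ∞) : WithTop ℕ∞) fun y : ℝ => (y : ℂ) := Complex.ofRealCLM.contDiff
  have h2 : ContDiff ℝ ((⊤ : ℕ∞) : WithTop ℕ∞) fun y : ℝ =>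
    Complex.exp (-Real.pi * b * (y : ℂ) ^ 2) := (contDiff_const.mul (h1.pow 2)).cexp
  exact h2.mul (f.smooth ⊤)

/-- The plateau function times the Gaussian chirp `exp (-π b y²)`. -/
noncomputable def gaussianChirp (b : ℂ) : 𝓢(ℝ, ℂ) :=
  HasCompactSupport.toSchwartzMap
    (f := fun y : ℝ => Complex.exp (-Real.pi * b * y ^ 2) * plateau y)
    (HasCompactSupport.mul_left hasCompactSupport_plateau) (contDiff_gaussian_mul b plateau)

theorem gaussianChirp_apply (b : ℂ) (y : ℝ) :
    gaussianChirp b y = Complex.exp (-Real.pi * b * y ^ 2) * plateau y := rfl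

theorem norm_gaussian (b : ℂ) (y : ℝ) :
    ‖Complex.exp (-Real.pi * b * (y : ℂ) ^ 2)‖ = Real.exp (-Real.pi * b.re * y ^ 2) := by
  rw [Complex.norm_exp]
  congr 1
  have : (-Real.pi * b * (y : ℂ) ^ 2 : ℂ) = ((-Real.pi * y ^ 2 : ℝ) : ℂ) * b := by
    push_cast; ring
  rw [this, Complex.re_ofReal_mul]
  ring

theorem norm_gaussianChirp_le {b : ℂ} (hb : 0 < b.re) (y : ℝ) :
    ‖gaussianChirp b y‖ ≤ ‖plateau y‖ := by
  rw [gaussianChirp_apply, norm_mul, norm_gaussian]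
  refine mul_le_of_le_one_left (norm_nonneg _) (Real.exp_le_one_iff.2 ?_)
  have := Real.pi_pos
  have : 0 ≤ Real.pi * b.re * y ^ 2 := by positivity
  linarith

/-- Moving the transform onto the Gaussian writes the left side as an integral of `𝓕⁻ plateau`
against a translated Gaussian with parameter `b⁻¹`. Its modulus is at most the prefactor, because
`b⁻¹` also has positive real part. -/
theorem norm_schwartzHat_gaussianChirp_le {b : ℂ} (hb : 0 < b.re) (ξ : ℝ) :
    ‖schwartzHat (gaussianChirp b) ξ‖
      ≤ ‖(1 / b ^ (1 / 2 : ℂ) : ℂ)‖ * ∫ η, ‖(𝓕⁻ plateau : 𝓢(ℝ, ℂ)) η‖ := by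
  set ψ : 𝓢(ℝ, ℂ) := 𝓕⁻ plateau with hψ
  have hψp : 𝓕 (ψ : ℝ → ℂ) = plateau := by
    have : (𝓕 ψ : 𝓢(ℝ, ℂ)) = plateau := FourierInvPair.fourier_fourierInv_eq _
    rw [fourier_coe_eq_schwartzHat, schwartzHat, this]
  set G : ℝ → ℂ := fun y => Complex.exp (-Real.pi * b * y ^ 2 +
    2 * Real.pi * (-(Complex.I * ξ)) * y) with hG
  have hGi : Integrable G := by
    have h := integrable_cexp_quadratic (b := Real.pi * b)
      (by rw [Complex.re_ofReal_mul]; positivity) (2 * Real.pi * (-(Complex.I * ξ))) 0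
    refine h.congr (Eventually.of_forall fun y => ?_)
    simp only [hG]
    congr 1
    ring
  have hFG : 𝓕 G = fun t : ℝ => 1 / b ^ (1 / 2 : ℂ) *
      Complex.exp (-Real.pi / b * (t + Complex.I * (-(Complex.I * ξ))) ^ 2) :=
    fourier_gaussian_pi' hb _
  have hself : ∫ η, 𝓕 G η • ψ η = ∫ y, G y • 𝓕 (ψ : ℝ → ℂ) y := by
    simpa using! VectorFourier.integral_fourierIntegral_smul_eq_flip (L := innerₗ ℝ)
      Real.continuous_fourierChar continuous_inner hGi ψ.integrable
  have hval : schwartzHat (gaussianChirp b) ξ = ∫ η, 𝓕 G η • ψ η := by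
    rw [hself, hψp, schwartzHat_apply]
    refine integral_congr_ae (Eventually.of_forall fun y => ?_)
    simp only [gaussianChirp_apply, hG, smul_eq_mul]
    rw [← mul_assoc, ← Complex.exp_add]
    congr 2
    ring
  rw [hval, ← integral_const_mul]
  refine norm_integral_le_of_norm_le (ψ.integrable.norm.const_mul _)
    (Eventually.of_forall fun η => ?_)
  rw [norm_smul, hFG, norm_mul]
  refine mul_le_mul_of_nonneg_right (mul_le_of_le_one_right (norm_nonneg _) ?_) (norm_nonneg _)
  have e : (-Real.pi / b * ((η : ℂ) + Complex.I * (-(Complex.I * ξ))) ^ 2 : ℂ)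
      = -Real.pi * b⁻¹ * ((η + ξ : ℝ) : ℂ) ^ 2 := by
    have : Complex.I * (-(Complex.I * ξ)) = (ξ : ℂ) := by
      linear_combination -(ξ : ℂ) * Complex.I_mul_I
    rw [this]
    push_cast
    ring
  rw [e, norm_gaussian]
  refine Real.exp_le_one_iff.2 ?_
  have h1 : 0 < (b⁻¹).re := by
    rw [Complex.inv_re]
    have : 0 < Complex.normSq b := Complex.normSq_pos.2 fun h => by simp [h] at hb
    positivity
  have := Real.pi_pos
  have : 0 ≤ Real.pi * (b⁻¹).re * (η + ξ) ^ 2 := by positivity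
  linarith

/-- A large imaginary part of `b` spreads the transform out: its sup norm decays like `‖b‖ ^
(-1/2)`, while Plancherel keeps its `L²` norm below that of the plateau. The modulus on `[-1, 1]`
depends only on the real part. -/
theorem exists_schwartz_eLpNorm_fourier_le {q : ℝ≥0∞} (hq : 2 < q) {η : ℝ} (hη : 0 < η) :
    ∃ f : 𝓢(ℝ, ℂ), (∀ y, |y| ≤ 1 → Real.exp (-Real.pi) ≤ ‖f y‖) ∧
      eLpNorm (𝓕 (f : ℝ → ℂ)) q volume ≤ ENNReal.ofReal η := by
  obtain ⟨A, hA, hAg⟩ := exists_eLpNorm_le_of_norm_le hq (K := ∫ x, ‖plateau x‖ ^ 2)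
    (by positivity) hη
  set L := ∫ η, ‖(𝓕⁻ plateau : 𝓢(ℝ, ℂ)) η‖ with hL
  have hL0 : 0 ≤ L := integral_nonneg fun _ => norm_nonneg _
  -- With `b = 1 + i t²` one has `‖b‖ ^ (1/2) ≥ t`, so the sup bound for the transform is at most `L
  -- / t ≤ A`.
  set t : ℝ := (L + 1) / A with ht
  have htpos : 0 < t := by positivity
  set b : ℂ := ⟨1, t ^ 2⟩ with hb
  have hbre : 0 < b.re := by simp [hb]
  have hbn : L * ‖(1 / b ^ (1 / 2 : ℂ) : ℂ)‖ ≤ A := by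
    have h1 : t ^ 2 ≤ ‖b‖ := by
      have := Complex.abs_im_le_norm b
      rwa [abs_of_nonneg (by positivity)] at this
    have h2 : ‖b ^ (1 / 2 : ℂ)‖ ^ 2 = ‖b‖ := by
      rw [← norm_pow]
      congr 1
      simp
    have h3 : t ≤ ‖b ^ (1 / 2 : ℂ)‖ := by
      refine le_of_sq_le_sq ?_ (norm_nonneg _)
      rw [h2]
      exact h1
    rw [norm_div, norm_one, mul_one_div, div_le_iff₀ (htpos.trans_le h3)]
    refine le_trans ?_ (mul_le_mul_of_nonneg_left h3 hA.le)
    rw [ht, mul_div_cancel₀ _ hA.ne']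
    linarith
  have hsq : ∀ f : 𝓢(ℝ, ℂ), Integrable fun x => ‖f x‖ ^ 2 := fun f =>
    (memLp_two_iff_integrable_sq_norm f.continuous.aestronglyMeasurable).1 (f.memLp 2 volume)
  refine ⟨gaussianChirp b, fun y hy => ?_, ?_⟩
  · rw [gaussianChirp_apply, plateau_eq_one (by linarith), mul_one, norm_gaussian]
    refine Real.exp_le_exp.2 ?_
    have h1 : y ^ 2 ≤ 1 := by rwa [sq_le_one_iff_abs_le_one]
    have := Real.pi_pos
    simp only [hb]
    nlinarith
  · rw [fourier_coe_eq_schwartzHat]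
    refine hAg _ (fun ξ => ?_) (hsq _) ?_
    · refine (norm_schwartzHat_gaussianChirp_le hbre ξ).trans ?_
      rw [mul_comm]
      exact hbn
    · have h := SchwartzMap.integral_norm_sq_fourier (gaussianChirp b)
      change ∫ ξ, ‖schwartzHat (gaussianChirp b) ξ‖ ^ 2 = _ at h
      rw [h]
      refine integral_mono (hsq _) (hsq _) fun y => ?_
      exact pow_le_pow_left₀ (norm_nonneg _) (norm_gaussianChirp_le hbre y) 2

/-- Necessity of `p > 2` for Wiener factors, up to equality. -/
theorem two_le_exponent_of_isWiener {n : ℕ} {ε : Fin n → ℤˣ} {X : Fin n → FactorSpace}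
    (hX : ∀ i, (X i).Admissible) (hbdd : IsMixedBounded ε X) {i : Fin n} (hi : (X i).IsWiener) :
    2 ≤ (X i).exponent := by
  obtain ⟨C, hC⟩ := hbdd
  by_contra hcon
  push Not at hcon
  have hq : 2 < (X i).exponent.conjExponent :=
    ENNReal.two_lt_conjExponent (FactorSpace.one_le_exponent (hX i)) hcon
  have hnorm : ∀ f : 𝓢(ℝ, ℂ), (X i).norm f
      = eLpNorm (𝓕 (f : ℝ → ℂ)) (X i).exponent.conjExponent volume := fun f => by
    cases h : X i with
    | lebesgue p => rw [h] at hi; exact hi.elim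
    | wiener p => rfl
  set K : ℝ≥0∞ := C * ∏ k ∈ Finset.univ.erase i, (X k).norm plateau with hK
  have hKt : K ≠ ∞ := ENNReal.mul_ne_top (by simp)
    (ENNReal.prod_lt_top fun k _ => (X k).norm_lt_top _).ne
  set δ : ℝ := Real.exp (-Real.pi) / 2 with hδ
  have hδ0 : 0 < δ := by positivity
  set V : ℝ≥0∞ := volume (Set.Icc (-1 : ℝ) 1) ^ (1 / ((∑ i, (X i).exponent⁻¹)⁻¹).toReal) with hV
  have hV0 : V ≠ 0 := by
    simp only [hV, Real.volume_Icc]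
    exact (ENNReal.rpow_pos (by norm_num) (by simp)).ne'
  have hVt : V ≠ ∞ := by
    simp only [hV, Real.volume_Icc]
    exact ENNReal.rpow_ne_top_of_nonneg (by positivity) (by simp)
  have key : ∀ η : ℝ, 0 < η → ENNReal.ofReal δ * V ≤ K * ENNReal.ofReal η := fun η hη => by
    obtain ⟨f, hf, hfn⟩ := exists_schwartz_eLpNorm_fourier_le hq hη
    set F : Fin n → 𝓢(ℝ, ℂ) := Function.update (fun _ => plateau) i f with hF
    -- Strictly increasing shifts remove every constraint, so the limit operator is a pointwise
    -- product.
    have hsec : limitSector (fun k : Fin n => (k : ℝ)) = Set.univ :=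
      limitSector_of_strictMono fun k l hkl => by exact_mod_cast hkl
    refine (lower_bound_le_prod_norm hX hC (fun k => (k : ℝ)) F (E := Set.Icc (-1) 1)
      measurableSet_Icc (by simp) hδ0 fun x hx => ?_).trans ?_
    · have hx1 : |x| ≤ 1 := abs_le.2 hx
      rw [hsec, sectorOp_univ, ← Finset.mul_prod_erase _ _ (Finset.mem_univ i),
        Finset.prod_eq_one, mul_one, hF, Function.update_self, hδ, mul_div_cancel₀ _ two_ne_zero]
      · exact hf _ (by rwa [abs_sign_mul])
      · intro k hk
        rw [hF, Function.update_of_ne (Finset.ne_of_mem_erase hk)]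
        exact plateau_eq_one (by rw [abs_sign_mul]; linarith)
    · rw [← Finset.mul_prod_erase _ _ (Finset.mem_univ i), hK, mul_assoc, mul_comm (∏ k ∈ _, _)]
      refine mul_le_mul_right ?_ _
      refine mul_le_mul' ?_ (Finset.prod_congr rfl fun k hk => ?_).le
      · rw [hF, Function.update_self, hnorm]
        exact hfn
      · rw [hF, Function.update_of_ne (Finset.ne_of_mem_erase hk)]
  have hlim : Tendsto (fun η : ℝ => K * ENNReal.ofReal η) (𝓝[>] 0) (𝓝 (K * ENNReal.ofReal 0)) :=
    (ENNReal.Tendsto.const_mul (ENNReal.continuous_ofReal.tendsto 0) (Or.inr hKt)).mono_left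
      nhdsWithin_le_nhds
  have hle := ge_of_tendsto hlim (eventually_nhdsWithin_of_forall fun η hη => key η hη)
  rw [ENNReal.ofReal_zero, mul_zero, nonpos_iff_eq_zero, mul_eq_zero] at hle
  rcases hle with h | h
  · exact absurd (ENNReal.ofReal_eq_zero.1 h) (not_le.2 hδ0)
  · exact hV0 h

/-! ### Bumps on disjoint tiles. -/

/-- The bump function adapted to the middle of the `k`-th of `N` tiles of `[0, 1]`, reflected by the
sign `s`. -/
noncomputable def tileBump {N : ℕ} (hN : 0 < N) (s : ℝ) (k : ℕ) :
    ContDiffBump (s * (((k : ℝ) + 1 / 2) / N)) :=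
  ⟨1 / (8 * N), 1 / (4 * N), by positivity, by
    have : (0 : ℝ) < N := by exact_mod_cast hN
    exact one_div_lt_one_div_of_lt (by positivity) (by linarith)⟩

theorem dist_sign_mul {s : ℝ} (hs : s = 1 ∨ s = -1) (x c : ℝ) : dist (s * x) (s * c) = |x - c| := by
  rw [Real.dist_eq, ← mul_sub, abs_mul]
  rcases hs with rfl | rfl <;> simp

theorem tileBump_eq_one {N : ℕ} (hN : 0 < N) {s : ℝ} (hs : s = 1 ∨ s = -1) {k : ℕ} {x : ℝ}
    (hx : |x - ((k : ℝ) + 1 / 2) / N| ≤ 1 / (8 * N)) : tileBump hN s k (s * x) = 1 := by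
  refine ContDiffBump.one_of_mem_closedBall _ ?_
  rw [Metric.mem_closedBall, dist_sign_mul hs]
  exact hx

theorem tileBump_eq_zero {N : ℕ} (hN : 0 < N) {s : ℝ} (hs : s = 1 ∨ s = -1) {k : ℕ} {x : ℝ}
    (hx : 1 / (4 * N) ≤ |x - ((k : ℝ) + 1 / 2) / N|) : tileBump hN s k (s * x) = 0 := by
  refine ContDiffBump.zero_of_le_dist _ ?_
  rw [dist_sign_mul hs]
  exact hx

theorem abs_mul_sub_lt_of_tileBump_ne_zero {N : ℕ} (hN : 0 < N) {s : ℝ} (hs : s = 1 ∨ s = -1)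
    {k : ℕ} {x : ℝ} (h : tileBump hN s k (s * x) ≠ 0) : |N * x - (k + 1 / 2)| < 1 / 4 := by
  have hN' : (0 : ℝ) < N := by exact_mod_cast hN
  by_contra hcon
  push Not at hcon
  refine h (tileBump_eq_zero hN hs ?_)
  have e : x - ((k : ℝ) + 1 / 2) / N = (N * x - (k + 1 / 2)) / N := by field_simp
  rw [e, abs_div, abs_of_pos hN', le_div_iff₀ hN']
  refine le_trans (le_of_eq ?_) hcon
  field_simp

theorem tileBump_eq_one_of_abs_mul_sub_le {N : ℕ} (hN : 0 < N) {s : ℝ} (hs : s = 1 ∨ s = -1)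
    {k : ℕ} {x : ℝ} (h : |N * x - (k + 1 / 2)| ≤ 1 / 8) : tileBump hN s k (s * x) = 1 := by
  have hN' : (0 : ℝ) < N := by exact_mod_cast hN
  refine tileBump_eq_one hN hs ?_
  have e : x - ((k : ℝ) + 1 / 2) / N = (N * x - (k + 1 / 2)) / N := by field_simp
  rw [e, abs_div, abs_of_pos hN', div_le_iff₀ hN']
  refine h.trans (le_of_eq ?_)
  field_simp

theorem eq_of_abs_sub_lt_half {k l : ℕ} {z : ℝ} (hk : |z - (k + 1 / 2)| < 1 / 2)
    (hl : |z - (l + 1 / 2)| < 1 / 2) : k = l := by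
  rw [abs_lt] at hk hl
  have h1 : (k : ℝ) < l + 1 := by linarith
  have h2 : (l : ℝ) < k + 1 := by linarith
  have h1' : k < l + 1 := by exact_mod_cast h1
  have h2' : l < k + 1 := by exact_mod_cast h2
  omega

/-- At most one tile bump is nonzero at a given point, and modulation does not change moduli. The
bound is therefore independent of both `N` and the frequencies. -/
theorem norm_sum_modulate_tileBump_le {N : ℕ} (hN : 0 < N) {s : ℝ} (hs : s = 1 ∨ s = -1)
    (a : ℕ → ℝ) (y : ℝ) :
    ‖(∑ k ∈ Finset.range N, modulate (a k) (schwartzBump (tileBump hN s k))) y‖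
      ≤ ‖(Set.Icc (-1 : ℝ) 1).indicator (fun _ => (1 : ℝ)) y‖ := by
  have hN' : (0 : ℝ) < N := by exact_mod_cast hN
  have hss : s * s = 1 := by rcases hs with rfl | rfl <;> norm_num
  have hy : y = s * (s * y) := by rw [← mul_assoc, hss, one_mul]
  rw [sum_apply]
  refine (norm_sum_le _ _).trans ?_
  have hb : ∀ k, ‖modulate (a k) (schwartzBump (tileBump hN s k)) y‖ = tileBump hN s k y := fun k => by
    rw [norm_modulate, schwartzBump_apply, Complex.norm_real,
      Real.norm_of_nonneg (ContDiffBump.nonneg _)]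
  simp only [hb]
  by_cases hex : ∃ k ∈ Finset.range N, tileBump hN s k y ≠ 0
  · obtain ⟨k, hk, hk0⟩ := hex
    rw [hy] at hk0
    have hk1 := abs_mul_sub_lt_of_tileBump_ne_zero hN hs hk0
    have hkN : (k : ℝ) + 1 ≤ N := by exact_mod_cast Finset.mem_range.1 hk
    rw [Finset.sum_eq_single_of_mem k hk]
    · have hmem : y ∈ Set.Icc (-1 : ℝ) 1 := by
        have h1 := abs_lt.1 hk1
        have hk0' : (0 : ℝ) ≤ k := Nat.cast_nonneg k
        have h2 : 0 ≤ s * y := by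
          by_contra hneg
          push Not at hneg
          nlinarith
        have h3 : s * y ≤ 1 := by
          by_contra hneg
          push Not at hneg
          nlinarith
        rcases hs with rfl | rfl <;> constructor <;> linarith
      rw [Set.indicator_of_mem hmem, norm_one]
      exact ContDiffBump.le_one _
    · intro l hl hlk
      by_contra hl0
      rw [hy] at hl0
      have hl1 := abs_mul_sub_lt_of_tileBump_ne_zero hN hs hl0
      exact hlk (eq_of_abs_sub_lt_half (hl1.trans (by norm_num)) (hk1.trans (by norm_num)))
  · push Not at hex
    rw [Finset.sum_eq_zero hex]
    exact norm_nonneg _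

/-! ### Frequencies that select the surviving terms. -/

/-- Frequencies of the test functions: the indices `a`, `b`, `d` form a block of neighbours, and the
remaining indices are placed far below or far above the block. -/
noncomputable def blockFreq {n : ℕ} (a b d : Fin n) (σ : ℝ) (N : ℕ) (j : Fin n) (k : ℕ) : ℝ :=
  if j = a ∨ j = b then σ * k else if j = d then σ * (k - 1 / 2)
  else if j < a then (j : ℝ) - n - N else (j : ℝ) + N

section Block

variable {n : ℕ} {a b d : Fin n} {σ : ℝ} {N : ℕ}

/-- Block frequencies lie strictly between `-N` and `N`; indices before the block are sent below
`-N`, indices after it to `N` or higher. Only pairs inside the block can be out of order or tied. -/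
theorem blockFreq_lt (hab : (b : ℕ) = a + 1)
    (hσ : (σ = 1 ∧ (d : ℕ) = b + 1) ∨ (σ = -1 ∧ (a : ℕ) = d + 1)) {i j : Fin n} (hij : i < j)
    (hQ : ¬((i = a ∨ i = b ∨ i = d) ∧ (j = a ∨ j = b ∨ j = d))) {k l : ℕ} (hk : k < N)
    (hl : l < N) : blockFreq a b d σ N i k < blockFreq a b d σ N j l := by
  have hij' : (i : ℕ) < j := hij
  have hbd : ∀ (i : Fin n) (k : ℕ), k < N → (i = a ∨ i = b ∨ i = d) →
      -(N : ℝ) < blockFreq a b d σ N i k ∧ blockFreq a b d σ N i k < N := fun i k hk hi => by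
    have hk' : (k : ℝ) + 1 ≤ N := by exact_mod_cast hk
    have hk0 : (0 : ℝ) ≤ k := Nat.cast_nonneg k
    unfold blockFreq
    split_ifs with h1 h2 h3
    · rcases hσ with ⟨rfl, _⟩ | ⟨rfl, _⟩ <;> constructor <;> linarith
    · rcases hσ with ⟨rfl, _⟩ | ⟨rfl, _⟩ <;> constructor <;> linarith
    · tauto
    · tauto
  have hlow : ∀ (i : Fin n) (k : ℕ), ¬(i = a ∨ i = b ∨ i = d) → i < a →
      blockFreq a b d σ N i k = (i : ℝ) - n - N := fun i k hi hia => by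
    have h1 : ¬(i = a ∨ i = b) := by tauto
    have h2 : i ≠ d := by tauto
    simp [blockFreq, h1, h2, hia]
  have hhigh : ∀ (i : Fin n) (k : ℕ), ¬(i = a ∨ i = b ∨ i = d) → ¬ i < a →
      blockFreq a b d σ N i k = (i : ℝ) + N := fun i k hi hia => by
    have h1 : ¬(i = a ∨ i = b) := by tauto
    have h2 : i ≠ d := by tauto
    simp [blockFreq, h1, h2, hia]
  have hin : (i : ℝ) + 1 ≤ n := by exact_mod_cast i.2
  have hjn : (j : ℝ) + 1 ≤ n := by exact_mod_cast j.2
  have hi0 : (0 : ℝ) ≤ i := Nat.cast_nonneg _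
  have hj0 : (0 : ℝ) ≤ j := Nat.cast_nonneg _
  have hN0 : (0 : ℝ) ≤ N := Nat.cast_nonneg _
  have hijr : (i : ℝ) < j := by exact_mod_cast hij'
  by_cases hi : i = a ∨ i = b ∨ i = d <;> by_cases hj : j = a ∨ j = b ∨ j = d
  · exact absurd ⟨hi, hj⟩ hQ
  · have hja : ¬ j < a := by
      simp only [Fin.ext_iff, Fin.lt_def] at *
      omega
    rw [hhigh j l hj hja]
    linarith [(hbd i k hk hi).2]
  · have hia : i < a := by
      simp only [Fin.ext_iff, Fin.lt_def] at *
      omega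
    rw [hlow i k hi hia]
    linarith [(hbd j l hl hj).1]
  · by_cases hia : i < a <;> by_cases hja : j < a
    · rw [hlow i k hi hia, hlow j l hj hja]
      linarith
    · rw [hlow i k hi hia, hhigh j l hj hja]
      linarith
    · exact absurd (hij.trans hja) hia
    · rw [hhigh i k hi hia, hhigh j l hj hja]
      linarith

/-- The offset `1/2` prevents ties with `d`, and `σ` accounts for `d` lying after or before the
pair: in both cases the order relative to `d` is correct exactly when `κ a` and `κ b` are below `κ
d`. Then a tie `κ a = κ b` leaves one constraint, and otherwise the order of `σ * κ a` and `σ * κ b`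
gives everything or nothing. -/
theorem limitSector_blockFreq (hab : (b : ℕ) = a + 1)
    (hσ : (σ = 1 ∧ (d : ℕ) = b + 1) ∨ (σ = -1 ∧ (a : ℕ) = d + 1)) {κ : Fin n → ℕ}
    (hκ : ∀ j, κ j < N) :
    (κ a = κ b ∧ κ a < κ d ∧ limitSector (fun j => blockFreq a b d σ N j (κ j)) = {ξ | ξ a < ξ b}) ∨
    (κ a ≠ κ b ∧ κ a ≠ κ d ∧
      limitSector (fun j => blockFreq a b d σ N j (κ j)) = Set.univ) ∨
    (¬(κ a = κ b ∧ κ a < κ d) ∧ limitSector (fun j => blockFreq a b d σ N j (κ j)) = ∅) := by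
  have hltab : a < b := by rw [Fin.lt_def]; omega
  have hda : d ≠ a := by rw [Ne, Fin.ext_iff]; omega
  have hdb : d ≠ b := by rw [Ne, Fin.ext_iff]; omega
  have ha : blockFreq a b d σ N a (κ a) = σ * κ a := by simp [blockFreq]
  have hb : blockFreq a b d σ N b (κ b) = σ * κ b := by simp [blockFreq]
  have hd : blockFreq a b d σ N d (κ d) = σ * (κ d - 1 / 2) := by simp [blockFreq, hda, hdb]
  have hout := fun (i j : Fin n) (hij : i < j) h =>
    blockFreq_lt hab hσ hij h (hκ i) (hκ j)
  have hle : ∀ {k l : ℕ}, k ≤ l → (k : ℝ) ≤ l := fun h => by exact_mod_cast h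
  have hlt : ∀ {k l : ℕ}, k < l → (k : ℝ) + 1 ≤ l := fun h => by exact_mod_cast h
  have hblock : ∀ i j : Fin n, i < j → ((i = a ∨ i = b ∨ i = d) ∧ (j = a ∨ j = b ∨ j = d)) →
      (i = a ∧ j = b) ∨ (σ = 1 ∧ ((i = a ∧ j = d) ∨ (i = b ∧ j = d))) ∨
      (σ = -1 ∧ ((i = d ∧ j = a) ∨ (i = d ∧ j = b))) := by
    intro i j hij hQ
    rcases hσ with ⟨hσ, hd⟩ | ⟨hσ, hd⟩
    · have : (i = a ∧ j = b) ∨ (i = a ∧ j = d) ∨ (i = b ∧ j = d) := by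
        simp only [Fin.ext_iff, Fin.lt_def] at *
        omega
      tauto
    · have : (i = a ∧ j = b) ∨ (i = d ∧ j = a) ∨ (i = d ∧ j = b) := by
        simp only [Fin.ext_iff, Fin.lt_def] at *
        omega
      tauto
  have hmain : ∀ h : (κ a : ℝ) + 1 ≤ κ d ∧ (κ b : ℝ) + 1 ≤ κ d, ∀ i j : Fin n, i < j →
      (blockFreq a b d σ N i (κ i) < blockFreq a b d σ N j (κ j) ∨ (i = a ∧ j = b)) := by
    intro h i j hij
    by_cases hQ : (i = a ∨ i = b ∨ i = d) ∧ (j = a ∨ j = b ∨ j = d)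
    · rcases hblock i j hij hQ with h1 | ⟨rfl, ⟨rfl, rfl⟩ | ⟨rfl, rfl⟩⟩ | ⟨rfl, ⟨rfl, rfl⟩ | ⟨rfl, rfl⟩⟩
      · exact Or.inr h1
      all_goals
        left
        simp only [ha, hb, hd]
        linarith [h.1, h.2]
    · exact Or.inl (hout i j hij hQ)
  by_cases hmax : κ a < κ d ∧ κ b < κ d
  · have hm := hmain ⟨hlt hmax.1, hlt hmax.2⟩
    by_cases heq : κ a = κ b
    · exact Or.inl ⟨heq, hmax.1, limitSector_pair hltab (by simp only [ha, hb]; rw [heq]) hm⟩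
    · right
      by_cases hord : σ * κ a < σ * κ b
      · refine Or.inl ⟨heq, hmax.1.ne, limitSector_of_strictMono fun i j hij => ?_⟩
        rcases hm i j hij with h | ⟨rfl, rfl⟩
        · exact h
        · simp only [ha, hb]
          exact hord
      · refine Or.inr ⟨fun h => heq h.1, limitSector_of_not_monotone hltab ?_⟩
        simp only [ha, hb]
        refine lt_of_le_of_ne (not_lt.1 hord) fun h => heq ?_
        have hσ0 : σ ≠ 0 := by rcases hσ with ⟨rfl, _⟩ | ⟨rfl, _⟩ <;> norm_num
        exact_mod_cast (mul_left_cancel₀ hσ0 h).symm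
  · refine Or.inr (Or.inr ⟨fun h => hmax ⟨h.2, h.1 ▸ h.2⟩, ?_⟩)
    have hmax' : κ d ≤ κ a ∨ κ d ≤ κ b := by omega
    rcases hσ with ⟨rfl, hdb'⟩ | ⟨rfl, had⟩
    · have had : a < d := by rw [Fin.lt_def]; omega
      have hbd : b < d := by rw [Fin.lt_def]; omega
      rcases hmax' with h | h
      · refine limitSector_of_not_monotone had ?_
        simp only [ha, hd]
        linarith [hle h]
      · refine limitSector_of_not_monotone hbd ?_
        simp only [hb, hd]
        linarith [hle h]
    · have hda' : d < a := by rw [Fin.lt_def]; omega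
      have hdb' : d < b := by rw [Fin.lt_def]; omega
      rcases hmax' with h | h
      · refine limitSector_of_not_monotone hda' ?_
        simp only [ha, hd]
        linarith [hle h]
      · refine limitSector_of_not_monotone hdb' ?_
        simp only [hb, hd]
        linarith [hle h]

end Block

/-! ### The block test functions and their harmonic sum. -/

/-- The `k`-th tile bump in the slots `a`, `b`, `d`, and the plateau in the other slots. -/
noncomputable def blockPiece {n : ℕ} (ε : Fin n → ℤˣ) (a b d : Fin n) {N : ℕ} (hN : 0 < N)
    (j : Fin n) (k : ℕ) : 𝓢(ℝ, ℂ) :=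
  if j = a ∨ j = b ∨ j = d then schwartzBump (tileBump hN ((ε j : ℤ) : ℝ) k) else plateau

/-- The index ranges of the pieces. -/
def blockRange {n : ℕ} (a b d : Fin n) (N : ℕ) (j : Fin n) : Finset ℕ :=
  if j = a ∨ j = b ∨ j = d then Finset.range N else {0}

/-- The index that is `k` in the slots `a` and `b`, `m` in the slot `d`, and zero elsewhere. -/
def blockIndex {n : ℕ} (a b d : Fin n) (k m : ℕ) (j : Fin n) : ℕ :=
  if j = a ∨ j = b then k else if j = d then m else 0

theorem sign_eq_one_or_neg_one {n : ℕ} (ε : Fin n → ℤˣ) (i : Fin n) :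
    ((ε i : ℤ) : ℝ) = 1 ∨ ((ε i : ℤ) : ℝ) = -1 := by
  rcases Int.units_eq_one_or (ε i) with h | h <;> simp [h]

section Block

variable {n : ℕ} {ε : Fin n → ℤˣ} {a b d : Fin n} {σ : ℝ} {N : ℕ}

theorem blockPiece_apply_eq_zero (hN : 0 < N) {j : Fin n} (hj : j = a ∨ j = b ∨ j = d) {k m : ℕ}
    {x : ℝ} (hx : |N * x - (m + 1 / 2)| ≤ 1 / 8) (hkm : k ≠ m) :
    blockPiece ε a b d hN j k (((ε j : ℤ) : ℝ) * x) = 0 := by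
  rw [blockPiece, if_pos hj, schwartzBump_apply]
  by_contra hcon
  have h := abs_mul_sub_lt_of_tileBump_ne_zero hN (sign_eq_one_or_neg_one ε j)
    (k := k) (x := x) fun h => hcon (by rw [h]; simp)
  exact hkm (eq_of_abs_sub_lt_half (h.trans (by norm_num)) (hx.trans_lt (by norm_num)))

/-- With one constraint, the slot `d` still enters as a pointwise factor and lives on tile `κ d`.
With none, slots `a` and `d` are both pointwise factors on different tiles, so one of them vanishes
at `x`. -/
theorem sectorOp_blockPiece_eq_zero (hN : 0 < N) (hab : (b : ℕ) = a + 1) (hε : SignDegenerate ε a b)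
    (hσ : (σ = 1 ∧ (d : ℕ) = b + 1) ∨ (σ = -1 ∧ (a : ℕ) = d + 1)) {κ : Fin n → ℕ}
    (hκ : ∀ j, κ j < N) {m : ℕ} {x : ℝ} (hx : |N * x - (m + 1 / 2)| ≤ 1 / 8)
    (h : ¬(κ a = κ b ∧ κ a < κ d ∧ κ d = m)) :
    sectorOp (limitSector fun j => blockFreq a b d σ N j (κ j)) ε
      (fun j => ⇑(blockPiece ε a b d hN j (κ j))) x = 0 := by
  have hda : d ≠ a := by rw [Ne, Fin.ext_iff]; omega
  have hdb : d ≠ b := by rw [Ne, Fin.ext_iff]; omega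
  have hne : a ≠ b := by rw [Ne, Fin.ext_iff]; omega
  rcases limitSector_blockFreq hab hσ hκ with ⟨h1, h2, h3⟩ | ⟨-, h1, h2⟩ | ⟨-, h1⟩
  · have hdm : κ d ≠ m := fun hd => h ⟨h1, h2, hd⟩
    rw [h3, sectorOp_pair_eq_mul ε hne hε.eq_neg fun j => blockPiece ε a b d hN j (κ j),
      Finset.prod_eq_zero (i := d), mul_zero]
    · simp [hda, hdb]
    · exact blockPiece_apply_eq_zero hN (by tauto) hx hdm
  · rw [h2, sectorOp_univ ε fun j => blockPiece ε a b d hN j (κ j)]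
    by_cases hdm : κ d = m
    · exact Finset.prod_eq_zero (Finset.mem_univ a)
        (blockPiece_apply_eq_zero hN (by tauto) hx (by rwa [hdm] at h1))
    · exact Finset.prod_eq_zero (Finset.mem_univ d)
        (blockPiece_apply_eq_zero hN (by tauto) hx hdm)
  · rw [h1]
    exact sectorOp_empty ε (fun j => blockPiece ε a b d hN j (κ j)) x

/-- The Cauchy integral has mass at least `1/(4N)` at distance at most `(m - k + 1)/N`. Its sign is
that of `ε a` for every `k`, which rules out cancellation when summing. -/
theorem sectorOp_blockPiece_blockIndex (hN : 0 < N) (hab : (b : ℕ) = a + 1)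
    (hε : SignDegenerate ε a b)
    (hσ : (σ = 1 ∧ (d : ℕ) = b + 1) ∨ (σ = -1 ∧ (a : ℕ) = d + 1)) {k m : ℕ} (hkm : k < m)
    (hmN : m < N) {x : ℝ} (hx : |N * x - (m + 1 / 2)| ≤ 1 / 8) :
    ∃ I : ℝ, sectorOp (limitSector fun j => blockFreq a b d σ N j (blockIndex a b d k m j)) ε
      (fun j => ⇑(blockPiece ε a b d hN j (blockIndex a b d k m j))) x
        = (2 * Real.pi * Complex.I)⁻¹ * ((((ε a : ℤ) : ℝ) * I : ℝ) : ℂ) ∧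
      1 / (4 * ((m : ℝ) - k + 1)) ≤ I := by
  have hda : d ≠ a := by rw [Ne, Fin.ext_iff]; omega
  have hdb : d ≠ b := by rw [Ne, Fin.ext_iff]; omega
  have hne : a ≠ b := by rw [Ne, Fin.ext_iff]; omega
  have hN' : (0 : ℝ) < N := by exact_mod_cast hN
  have hkm' : (k : ℝ) + 1 ≤ m := by exact_mod_cast hkm
  set κ := blockIndex a b d k m with hκdef
  have hκa : κ a = k := by simp [hκdef, blockIndex]
  have hκb : κ b = k := by simp [hκdef, blockIndex]
  have hκd : κ d = m := by simp [hκdef, blockIndex, hda, hdb]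
  have hκ : ∀ j, κ j < N := fun j => by
    simp only [hκdef, blockIndex]
    split_ifs <;> omega
  have hsec : limitSector (fun j => blockFreq a b d σ N j (κ j)) = {ξ | ξ a < ξ b} := by
    have hlt : κ a < κ d := by rw [hκa, hκd]; exact hkm
    have heq : κ a = κ b := by rw [hκa, hκb]
    rcases limitSector_blockFreq hab hσ hκ with ⟨-, -, h⟩ | ⟨h, -⟩ | ⟨h, -⟩
    · exact h
    · exact absurd heq h
    · exact absurd ⟨heq, hlt⟩ h
  have hsa := sign_eq_one_or_neg_one ε a
  have hsb := sign_eq_one_or_neg_one ε b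
  set s : ℝ := ((ε a : ℤ) : ℝ) with hs
  have hss : s * s = 1 := by rcases hsa with h | h <;> rw [h] <;> norm_num
  have hb : ((ε b : ℤ) : ℝ) = -s := by simp [hs, hε.eq_neg]
  set h : ℝ → ℝ := fun y => tileBump hN s k y * tileBump hN (-s) k (-y) with hh
  have hF : ∀ y : ℝ, blockPiece ε a b d hN a (κ a) y * blockPiece ε a b d hN b (κ b) (-y)
      = (h y : ℂ) := fun y => by
    rw [blockPiece, blockPiece, if_pos (by tauto), if_pos (by tauto), hκa, hκb, schwartzBump_apply,
      schwartzBump_apply]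
    have hcongr : ∀ t, t = -s → tileBump hN t k (-y) = tileBump hN (-s) k (-y) := by
      rintro _ rfl; rfl
    rw [hcongr _ hb, ← Complex.ofReal_mul]
  have hsupp : ∀ y, h y ≠ 0 → |N * (s * y) - (k + 1 / 2)| < 1 / 4 := fun y hy => by
    refine abs_mul_sub_lt_of_tileBump_ne_zero hN hsa ?_
    rw [← mul_assoc, hss, one_mul]
    exact left_ne_zero_of_mul hy
  -- In units of `1/N`, `x` is within `1/8` of the middle of tile `m` and `s * y` within `1/4` of
  -- the middle of tile `k < m`, so their distance lies between `m - k - 3/8` and `m - k + 3/8`.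
  have hgap : ∀ y, h y ≠ 0 → 5 / (8 * N) ≤ s * (s * x - y) ∧
      s * (s * x - y) ≤ ((m : ℝ) - k + 1) / N := fun y hy => by
    have h1 := abs_lt.1 (hsupp y hy)
    have h2 := abs_le.1 hx
    have e : s * (s * x - y) = (N * x - N * (s * y)) / N := by
      field_simp
      linear_combination x * hss
    have e2 : 5 / (8 * (N : ℝ)) = (5 / 8) / N := by field_simp
    rw [e, e2, div_le_div_iff_of_pos_right hN', div_le_div_iff_of_pos_right hN']
    constructor <;> linarith
  have hcont : Continuous h := (ContDiffBump.continuous _).mul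
    ((ContDiffBump.continuous _).comp continuous_neg)
  have hcs : HasCompactSupport h := (ContDiffBump.hasCompactSupport _).mul_right
  have hx0 : ∀ y, |y - s * x| < 5 / (8 * N) → blockPiece ε a b d hN a (κ a) y *
      blockPiece ε a b d hN b (κ b) (-y) = 0 := fun y hy => by
    rw [hF]
    by_contra hcon
    have h1 := (hgap y fun h => hcon (by rw [h]; simp)).1
    have h2 : s * (s * x - y) ≤ |y - s * x| := by
      refine (le_abs_self _).trans (le_of_eq ?_)
      rw [abs_mul, abs_sub_comm]
      rcases hsa with h | h <;> rw [h] <;> simp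
    linarith
  obtain ⟨I, hI, hI2⟩ := exists_cauchy_integral_eq (hcont.integrable_of_hasCompactSupport hcs)
    (fun y => mul_nonneg (ContDiffBump.nonneg _) (ContDiffBump.nonneg _)) (s := s) (u := s * x)
    (δ := 5 / (8 * N)) (D := ((m : ℝ) - k + 1) / N) (c := s * (((k : ℝ) + 1 / 2) / N))
    (r := 1 / (8 * N)) hsa (by positivity) (div_pos (by linarith) hN') (by positivity) hgap
    (fun y hy => by
      have hy' : y = s * (s * y) := by rw [← mul_assoc, hss, one_mul]
      have hy2 : -y = -s * (s * y) := by rw [neg_mul, ← hy']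
      have hy3 : |s * y - ((k : ℝ) + 1 / 2) / N| ≤ 1 / (8 * N) := by
        rw [hy', ← Real.dist_eq, dist_sign_mul hsa] at hy
        exact hy
      have h1 : tileBump hN s k y = 1 := by
        rw [hy']
        exact tileBump_eq_one hN hsa hy3
      have h2 : tileBump hN (-s) k (-y) = 1 := by
        rw [hy2]
        exact tileBump_eq_one hN (by rwa [hb] at hsb) hy3
      simp only [hh, h1, h2, one_mul])
  refine ⟨I, ?_, ?_⟩
  · rw [hsec, sectorOp_pair ε hne hε.eq_neg (fun j => blockPiece ε a b d hN j (κ j))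
      (δ := 5 / (8 * N)) (by positivity) hx0, Finset.prod_eq_one, mul_one]
    · simp only [hF]
      rw [hI]
    · intro j hj
      have hj' : ¬(j = a ∨ j = b) := by simpa using hj
      by_cases hjd : j = d
      · subst hjd
        rw [blockPiece, if_pos (by tauto), schwartzBump_apply, hκd,
          tileBump_eq_one_of_abs_mul_sub_le hN (sign_eq_one_or_neg_one ε j) hx]
        simp
      · rw [blockPiece, if_neg (by tauto)]
        refine plateau_eq_one ?_
        rw [abs_sign_mul]
        have h2 := abs_le.1 hx
        have hmN' : (m : ℝ) + 1 ≤ N := by exact_mod_cast hmN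
        have hm0 : (0 : ℝ) ≤ m := Nat.cast_nonneg m
        have h3 : 0 ≤ x := by
          by_contra hneg
          push Not at hneg
          nlinarith
        rw [abs_of_nonneg h3]
        by_contra hneg
        push Not at hneg
        nlinarith
  · refine le_trans (le_of_eq ?_) hI2
    have : (m : ℝ) - k + 1 ≠ 0 := by linarith
    field_simp
    norm_num

/-- Slots `a` and `b` are shifted by the same `σ * k` with opposite signs, so `k` drops out of the
phase and the terms for different `k` add coherently. -/
theorem signedWave_blockFreq_blockIndex (hab : (b : ℕ) = a + 1) (hε : SignDegenerate ε a b)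
    (x M : ℝ) (k m : ℕ) :
    signedWave ε x (M • fun j => blockFreq a b d σ N j (blockIndex a b d k m j))
      = signedWave ε x (M • fun j => blockFreq a b d σ N j (blockIndex a b d 0 m j)) := by
  have hne : a ≠ b := by rw [Ne, Fin.ext_iff]; omega
  have hb : ((ε b : ℤ) : ℂ) = -((ε a : ℤ) : ℂ) := by simp [hε.eq_neg]
  have hj : (fun j => blockFreq a b d σ N j (blockIndex a b d k m j))
      = (fun j => blockFreq a b d σ N j (blockIndex a b d 0 m j)) +
        fun j => if j = a ∨ j = b then σ * k else 0 := by
    funext j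
    by_cases h : j = a ∨ j = b
    · simp [blockFreq, blockIndex, h]
    · simp [blockFreq, blockIndex, h]
  have h1 : signedWave ε x (M • fun j => if j = a ∨ j = b then σ * k else 0) = 1 := by
    rw [signedWave]
    have : ∑ i, ((ε i : ℤ) : ℂ) *
        (((M • fun j => if j = a ∨ j = b then σ * k else 0) i : ℝ) : ℂ) = 0 := by
      rw [← Finset.sum_subset (Finset.subset_univ {a, b})]
      · rw [Finset.sum_pair hne]
        simp [hb]
      · intro j _ hj
        have : ¬(j = a ∨ j = b) := by simpa using hj
        simp [this]
    rw [this, mul_zero, Complex.exp_zero]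
  rw [hj, smul_add, signedWave_add, h1, mul_one]

/-- The limiting output of the block test functions on the `m`-th tile is a partial harmonic sum. -/
theorem le_norm_sum_sectorOp_blockPiece (hN : 0 < N) (hab : (b : ℕ) = a + 1)
    (hε : SignDegenerate ε a b)
    (hσ : (σ = 1 ∧ (d : ℕ) = b + 1) ∨ (σ = -1 ∧ (a : ℕ) = d + 1)) {m : ℕ} (hmN : m < N)
    {x : ℝ} (hx : |N * x - (m + 1 / 2)| ≤ 1 / 8) (M : ℝ) :
    (∑ i ∈ Finset.range m, 1 / ((i : ℝ) + 1)) / 64 ≤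
      ‖∑ κ ∈ Fintype.piFinset (blockRange a b d N),
        signedWave ε x (M • fun j => blockFreq a b d σ N j (κ j)) *
          sectorOp (limitSector fun j => blockFreq a b d σ N j (κ j)) ε
            (fun j => ⇑(blockPiece ε a b d hN j (κ j))) x‖ := by
  have hda : d ≠ a := by rw [Ne, Fin.ext_iff]; omega
  have hdb : d ≠ b := by rw [Ne, Fin.ext_iff]; omega
  have hκN : ∀ κ ∈ Fintype.piFinset (blockRange a b d N), ∀ j, κ j < N := fun κ hκ j => by
    have := Fintype.mem_piFinset.1 hκ j
    unfold blockRange at this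
    split_ifs at this
    · exact Finset.mem_range.1 this
    · rw [Finset.mem_singleton.1 this]
      exact hN
  have hex : ∀ k : ℕ, ∃ I : ℝ, k < m → (sectorOp
      (limitSector fun j => blockFreq a b d σ N j (blockIndex a b d k m j)) ε
      (fun j => ⇑(blockPiece ε a b d hN j (blockIndex a b d k m j))) x
        = (2 * Real.pi * Complex.I)⁻¹ * ((((ε a : ℤ) : ℝ) * I : ℝ) : ℂ) ∧
      1 / (4 * ((m : ℝ) - k + 1)) ≤ I) := fun k => by
    by_cases hk : k < m
    · obtain ⟨I, hI⟩ := sectorOp_blockPiece_blockIndex hN hab hε hσ hk hmN hx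
      exact ⟨I, fun _ => hI⟩
    · exact ⟨0, fun h => absurd h hk⟩
  choose I hI using hex
  -- Only the indices `blockIndex a b d k m` with `k < m` contribute; they share one phase, which is
  -- pulled out of the sum.
  rw [← Finset.sum_of_injOn (s := Finset.range m)
    (f := fun k => signedWave ε x (M • fun j => blockFreq a b d σ N j (blockIndex a b d 0 m j)) *
      ((2 * Real.pi * Complex.I)⁻¹ * ((((ε a : ℤ) : ℝ) * I k : ℝ) : ℂ)))
    (fun k => blockIndex a b d k m)]
  · rw [← Finset.mul_sum, ← Finset.mul_sum, norm_mul, norm_signedWave, one_mul,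
      ← Complex.ofReal_sum, ← Finset.mul_sum, norm_two_pi_I_inv_mul_ofReal, abs_sign_mul,
      le_div_iff₀ (by positivity), ← Finset.sum_range_reflect]
    refine le_trans ?_ (le_abs_self _)
    rw [div_mul_eq_mul_div, Finset.sum_mul, Finset.sum_div]
    refine Finset.sum_le_sum fun k hk => ?_
    have hk' := Finset.mem_range.1 hk
    refine le_trans ?_ (hI k hk').2
    have hcast : ((m - 1 - k : ℕ) : ℝ) = m - 1 - k := by
      rw [Nat.sub_sub, Nat.cast_sub (by omega)]
      push_cast
      ring
    rw [hcast]
    have hkm : (k : ℝ) + 1 ≤ m := by exact_mod_cast hk'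
    have hpos : 0 < (m : ℝ) - 1 - k + 1 := by linarith
    -- With `j = m - k` the claim is `2π / (64 j) ≤ 1 / (4 (j + 1))`, true since `π ≤ 4` and `j ≥
    -- 1`.
    rw [div_mul_eq_mul_div, div_div, div_le_div_iff₀ (by positivity) (by linarith)]
    nlinarith [Real.pi_le_four, Real.pi_pos]
  · intro k _ l _ hkl
    have := congrFun hkl a
    simpa [blockIndex] using this
  · intro k hk
    have hk' : k < m := by simpa using hk
    rw [Finset.mem_coe, Fintype.mem_piFinset]
    intro j
    simp only [blockRange, blockIndex]
    by_cases h1 : j = a ∨ j = b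
    · have h2 : j = a ∨ j = b ∨ j = d := by tauto
      simp only [h1, h2, if_true, Finset.mem_range]
      omega
    · by_cases h3 : j = d
      · have h2 : j = a ∨ j = b ∨ j = d := by tauto
        rw [if_pos h2, if_neg h1, if_pos h3]
        simpa using hmN
      · have h2 : ¬(j = a ∨ j = b ∨ j = d) := by tauto
        rw [if_neg h2, if_neg h1, if_neg h3]
        simp
  · intro κ hκ hnot
    rw [sectorOp_blockPiece_eq_zero hN hab hε hσ (hκN κ hκ) hx, mul_zero]
    rintro ⟨h1, h2, h3⟩
    refine hnot ⟨κ a, by simpa [← h3] using h2, funext fun j => ?_⟩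
    have hj := Fintype.mem_piFinset.1 hκ j
    simp only [blockIndex]
    split_ifs with h4 h5
    · rcases h4 with rfl | rfl
      · rfl
      · exact h1
    · rw [h5, h3]
    · have h2 : ¬(j = a ∨ j = b ∨ j = d) := by tauto
      rw [blockRange, if_neg h2] at hj
      exact (Finset.mem_singleton.1 hj).symm
  · intro k hk
    rw [(hI k (Finset.mem_range.1 hk)).1, signedWave_blockFreq_blockIndex hab hε x M k m]

end Block

/-! ### Divergence on a set of fixed measure. -/

/-- The middle parts of the tiles of the right half of `[0, 1]`. -/
def tileMiddles (N₀ : ℕ) : Set ℝ :=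
  ⋃ m ∈ Finset.Ico N₀ (2 * N₀),
    Metric.closedBall (((m : ℝ) + 1 / 2) / (2 * N₀ : ℕ)) (1 / (8 * (2 * N₀ : ℕ)))

theorem measurableSet_tileMiddles (N₀ : ℕ) : MeasurableSet (tileMiddles N₀) :=
  Finset.measurableSet_biUnion _ fun _ _ => Metric.isClosed_closedBall.measurableSet

theorem abs_mul_sub_le_of_mem_closedBall {N : ℕ} (hN : 0 < N) {m : ℕ} {x : ℝ}
    (hx : x ∈ Metric.closedBall (((m : ℝ) + 1 / 2) / N) (1 / (8 * N))) :
    |N * x - (m + 1 / 2)| ≤ 1 / 8 := by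
  have hN' : (0 : ℝ) < N := by exact_mod_cast hN
  rw [Metric.mem_closedBall, Real.dist_eq] at hx
  have e : (N : ℝ) * x - (m + 1 / 2) = N * (x - (m + 1 / 2) / N) := by field_simp
  rw [e, abs_mul, abs_of_pos hN']
  refine (mul_le_mul_of_nonneg_left hx hN'.le).trans (le_of_eq ?_)
  field_simp

/-- There are `N₀` disjoint intervals of length `1/(8 N₀)`, so the measure does not shrink as the
tiles are refined. -/
theorem volume_tileMiddles {N₀ : ℕ} (hN : 0 < N₀) :
    volume (tileMiddles N₀) = ENNReal.ofReal (1 / 8) := by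
  have hN' : (0 : ℝ) < N₀ := by exact_mod_cast hN
  rw [tileMiddles, measure_biUnion_finset]
  · simp only [Real.volume_closedBall]
    rw [Finset.sum_const, Nat.card_Ico, ← ENNReal.ofReal_nsmul]
    congr 1
    have : 2 * N₀ - N₀ = N₀ := by omega
    rw [this, nsmul_eq_mul]
    push_cast
    field_simp
  · intro m _ l _ hml
    refine Set.disjoint_left.2 fun x hx hx' => hml ?_
    exact eq_of_abs_sub_lt_half
      ((abs_mul_sub_le_of_mem_closedBall (by omega) hx).trans_lt (by norm_num))
      ((abs_mul_sub_le_of_mem_closedBall (by omega) hx').trans_lt (by norm_num))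
  · exact fun _ _ => Metric.isClosed_closedBall.measurableSet

/-- Multilinearity expands the output into finitely many terms, so one `M` makes all of them close
to their limits. Restricting to tiles `m ≥ N₀` makes every partial harmonic sum at least the one of
length `N₀`. -/
theorem exists_modulated_lower_bound {n : ℕ} {ε : Fin n → ℤˣ} {a b d : Fin n} {σ : ℝ} {N₀ : ℕ}
    (hN₀ : 0 < N₀) (hN : 0 < 2 * N₀) (hab : (b : ℕ) = a + 1) (hε : SignDegenerate ε a b)
    (hσ : (σ = 1 ∧ (d : ℕ) = b + 1) ∨ (σ = -1 ∧ (a : ℕ) = d + 1)) :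
    ∃ M : ℕ, ∀ x ∈ tileMiddles N₀, (∑ i ∈ Finset.range N₀, 1 / ((i : ℝ) + 1)) / 128 ≤
      ‖orderedOscOp ε (fun j => ⇑(∑ k ∈ blockRange a b d (2 * N₀) j,
        modulate (M * blockFreq a b d σ (2 * N₀) j k) (blockPiece ε a b d hN j k))) x‖ := by
  set S := Fintype.piFinset (blockRange a b d (2 * N₀)) with hS
  set H := ∑ i ∈ Finset.range N₀, 1 / ((i : ℝ) + 1) with hH
  have hH0 : 0 < H := Finset.sum_pos (fun i _ => by positivity) ⟨0, by simpa using hN₀⟩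
  -- The errors of all the terms together then cost at most `H / 128`, half of the lower bound `H /
  -- 64`.
  have hη : 0 < H / 128 / (S.card + 1) := by positivity
  have hev : ∀ᶠ M : ℕ in atTop, ∀ κ ∈ S, ∀ x,
      ‖orderedOscOp ε (fun j => ⇑(modulate (M * blockFreq a b d σ (2 * N₀) j (κ j))
          (blockPiece ε a b d hN j (κ j)))) x
        - signedWave ε x ((M : ℝ) • fun j => blockFreq a b d σ (2 * N₀) j (κ j)) *
          sectorOp (limitSector fun j => blockFreq a b d σ (2 * N₀) j (κ j)) ε
            (fun j => ⇑(blockPiece ε a b d hN j (κ j))) x‖ ≤ H / 128 / (S.card + 1) :=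
    (eventually_all_finset S).2 fun κ _ => eventually_norm_orderedOscOp_modulate_sub_le ε
      (fun j => blockPiece ε a b d hN j (κ j)) (fun j => blockFreq a b d σ (2 * N₀) j (κ j)) hη
  obtain ⟨M, hM⟩ := hev.exists
  refine ⟨M, fun x hx => ?_⟩
  rw [tileMiddles] at hx
  simp only [Set.mem_iUnion] at hx
  obtain ⟨m, hm, hx⟩ := hx
  rw [Finset.mem_Ico] at hm
  have hx' := abs_mul_sub_le_of_mem_closedBall hN hx
  have hlow := le_norm_sum_sectorOp_blockPiece hN hab hε hσ hm.2 hx' M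
  rw [← hS] at hlow
  have hHm : H ≤ ∑ i ∈ Finset.range m, 1 / ((i : ℝ) + 1) :=
    Finset.sum_le_sum_of_subset_of_nonneg (Finset.range_mono hm.1) fun i _ _ => by positivity
  rw [orderedOscOp_sum ε (blockRange a b d (2 * N₀)) fun j k =>
    modulate (M * blockFreq a b d σ (2 * N₀) j k) (blockPiece ε a b d hN j k), ← hS]
  set P : (Fin n → ℕ) → ℂ := fun κ => orderedOscOp ε
    (fun j => ⇑(modulate (M * blockFreq a b d σ (2 * N₀) j (κ j))
      (blockPiece ε a b d hN j (κ j)))) x with hP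
  set Q : (Fin n → ℕ) → ℂ := fun κ =>
    signedWave ε x ((M : ℝ) • fun j => blockFreq a b d σ (2 * N₀) j (κ j)) *
      sectorOp (limitSector fun j => blockFreq a b d σ (2 * N₀) j (κ j)) ε
        (fun j => ⇑(blockPiece ε a b d hN j (κ j))) x with hQ
  change _ ≤ ‖∑ κ ∈ S, Q κ‖ at hlow
  change _ ≤ ‖∑ κ ∈ S, P κ‖
  have hdiff : ‖∑ κ ∈ S, P κ - ∑ κ ∈ S, Q κ‖ ≤ H / 128 := by
    rw [← Finset.sum_sub_distrib]
    refine (norm_sum_le_of_le S fun κ hκ => hM κ hκ x).trans ?_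
    rw [Finset.sum_const, nsmul_eq_mul, ← mul_div_assoc, div_le_iff₀ (by positivity)]
    nlinarith
  have htri := norm_sub_norm_le (∑ κ ∈ S, Q κ) (∑ κ ∈ S, P κ)
  rw [norm_sub_rev] at htri
  linarith

/-- This is where the absence of Wiener factors in the block enters: Lebesgue norms see only the
modulus, which is controlled by disjointness of the tiles. Outside the block a single modulated
plateau is used, so any factor space is allowed. -/
theorem norm_sum_blockPiece_le {n : ℕ} {ε : Fin n → ℤˣ} {X : Fin n → FactorSpace} {a b d : Fin n}
    {N : ℕ} (hN : 0 < N) (hL : ∀ j, j = a ∨ j = b ∨ j = d → ¬(X j).IsWiener) (ω : Fin n → ℕ → ℝ)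
    (j : Fin n) :
    (X j).norm (∑ k ∈ blockRange a b d N j, modulate (ω j k) (blockPiece ε a b d hN j k) : 𝓢(ℝ, ℂ))
      ≤ (X j).norm plateau + eLpNorm ((Set.Icc (-1 : ℝ) 1).indicator fun _ => (1 : ℝ))
        (X j).exponent volume := by
  by_cases hj : j = a ∨ j = b ∨ j = d
  · refine le_add_left ?_
    have hLj := hL j hj
    cases hX : X j with
    | wiener p => rw [hX] at hLj; exact absurd trivial hLj
    | lebesgue p =>
      simp only [FactorSpace.norm, FactorSpace.exponent]
      refine eLpNorm_mono fun y => ?_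
      simp only [blockRange, blockPiece, if_pos hj]
      exact norm_sum_modulate_tileBump_le hN (sign_eq_one_or_neg_one ε j) (ω j) y
  · refine le_add_right (le_of_eq ?_)
    simp only [blockRange, blockPiece, if_neg hj, Finset.sum_singleton]
    exact FactorSpace.norm_modulate _ _ _

/-- A degenerate pair adjacent to a third index forces a Wiener factor among the three. -/
theorem exists_isWiener_of_degenerate_block {n : ℕ} {ε : Fin n → ℤˣ} {X : Fin n → FactorSpace}
    (hX : ∀ i, (X i).Admissible) (hbdd : IsMixedBounded ε X) {a b d : Fin n}
    (hab : (b : ℕ) = a + 1) (hε : SignDegenerate ε a b)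
    (hd : (d : ℕ) = b + 1 ∨ (a : ℕ) = d + 1) :
    ∃ j, (j = a ∨ j = b ∨ j = d) ∧ (X j).IsWiener := by
  by_contra hcon
  push Not at hcon
  obtain ⟨C, hC⟩ := hbdd
  obtain ⟨σ, hσ⟩ : ∃ σ : ℝ, (σ = 1 ∧ (d : ℕ) = b + 1) ∨ (σ = -1 ∧ (a : ℕ) = d + 1) := by
    rcases hd with h | h
    · exact ⟨1, Or.inl ⟨rfl, h⟩⟩
    · exact ⟨-1, Or.inr ⟨rfl, h⟩⟩
  set K : ℝ≥0∞ := C * ∏ j, ((X j).norm plateau +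
    eLpNorm ((Set.Icc (-1 : ℝ) 1).indicator fun _ => (1 : ℝ)) (X j).exponent volume) with hK
  have hKt : K ≠ ∞ := by
    refine ENNReal.mul_ne_top (by simp) (ENNReal.prod_lt_top fun j _ => ?_).ne
    refine ENNReal.add_lt_top.2 ⟨(X j).norm_lt_top _, ?_⟩
    exact (memLp_indicator_const _ measurableSet_Icc _ (Or.inr (by simp))).2
  set V : ℝ≥0∞ := ENNReal.ofReal (1 / 8) ^ (1 / ((∑ i, (X i).exponent⁻¹)⁻¹).toReal) with hV
  have h8 : ENNReal.ofReal (1 / 8) ≠ 0 := by simp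
  have hV0 : V ≠ 0 := (ENNReal.rpow_pos (pos_iff_ne_zero.2 h8) (by simp)).ne'
  have key : ∀ N₀ : ℕ, 0 < N₀ →
      (∑ i ∈ Finset.range N₀, 1 / ((i : ℝ) + 1)) / 128 ≤ (K / V).toReal := fun N₀ hN₀ => by
    have hN : 0 < 2 * N₀ := by omega
    obtain ⟨M, hM⟩ := exists_modulated_lower_bound hN₀ hN hab hε hσ
    have hvol := volume_tileMiddles hN₀
    have h1 := ofReal_mul_volume_rpow_le_eLpNorm (measurableSet_tileMiddles N₀)
      (by rw [hvol]; exact h8)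
      (div_nonneg (Finset.sum_nonneg fun i _ => by positivity) (by norm_num)) hM (exponent_sum_inv_ne_zero hX)
    rw [hvol] at h1
    have h2 := h1.trans (hC _)
    have h3 := h2.trans (mul_le_mul_right (Finset.prod_le_prod' fun j _ =>
      norm_sum_blockPiece_le hN hcon
        (fun j k => M * blockFreq a b d σ (2 * N₀) j k) j) _)
    rw [← ENNReal.le_div_iff_mul_le (Or.inl hV0) (Or.inr hKt)] at h3
    exact (ENNReal.ofReal_le_iff_le_toReal (ENNReal.div_ne_top hKt hV0)).1 h3
  obtain ⟨N₀, hN₀, hbig⟩ := ((eventually_gt_atTop 0).and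
    (Real.tendsto_sum_range_one_div_nat_succ_atTop.eventually_gt_atTop
      (128 * (K / V).toReal))).exists
  linarith [key N₀ hN₀]

/-! ### Conclusion: the endpoint cases are excluded by the hypotheses. -/

theorem mainTheorem9 (n : ℕ) (hn : 2 ≤ n) (ε : Fin n → ℤˣ) (X : Fin n → FactorSpace)
    (hX : ∀ i, (X i).Admissible)
    (hW : ∀ i j : Fin n, (X i).IsWiener → ((j : ℕ) = i + 1 ∨ (i : ℕ) = j + 1) →
      SignDegenerate ε i j)
    (hne : ∀ i j : Fin n, (j : ℕ) = i + 1 → SignDegenerate ε i j →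
      (X i).exponent⁻¹ + (X j).exponent⁻¹ ≠ 1)
    (hbdd : IsMixedBounded ε X) :
    (∀ i, (X i).IsWiener → 2 < (X i).exponent) ∧
    (∀ i j k : Fin n, (j : ℕ) = i + 1 → (k : ℕ) = j + 1 →
      (SignDegenerate ε i j ∨ SignDegenerate ε j k) →
      ((X i).IsWiener ∨ (X j).IsWiener ∨ (X k).IsWiener)) ∧
    (∀ i j : Fin n, (j : ℕ) = i + 1 → SignDegenerate ε i j →
      (X i).exponent⁻¹ + (X j).exponent⁻¹ < 1) := by
  refine ⟨fun i hi => ?_, fun i j k hij hjk h => ?_, fun i j hij hε => ?_⟩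
  · refine lt_of_le_of_ne (two_le_exponent_of_isWiener hX hbdd hi) fun h => ?_
    have hXi := hX i
    cases hc : X i with
    | lebesgue p => rw [hc] at hi; exact hi
    | wiener p =>
      rw [hc] at hXi h
      exact hXi.2 h.symm
  · rcases h with h | h
    · obtain ⟨l, rfl | rfl | rfl, hl⟩ :=
        exists_isWiener_of_degenerate_block hX hbdd hij h (d := k) (Or.inl hjk)
      exacts [Or.inl hl, Or.inr (Or.inl hl), Or.inr (Or.inr hl)]
    · obtain ⟨l, rfl | rfl | rfl, hl⟩ :=
        exists_isWiener_of_degenerate_block hX hbdd hjk h (d := i) (Or.inr hij)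
      exacts [Or.inr (Or.inl hl), Or.inr (Or.inr hl), Or.inl hl]
  · refine lt_of_le_of_ne ?_ (hne i j hij hε)
    have h := exponent_inv_add_exponent_inv_le_one hX hbdd hij hε
    have hfin : ∀ k, (X k).exponent⁻¹ ≠ ∞ := fun k =>
      ((ENNReal.inv_le_one.2 (FactorSpace.one_le_exponent (hX k))).trans_lt ENNReal.one_lt_top).ne
    rw [← ENNReal.toReal_add (hfin i) (hfin j)] at h
    rw [← ENNReal.ofReal_toReal (ENNReal.add_ne_top.2 ⟨hfin i, hfin j⟩), ← ENNReal.ofReal_one]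
    exact ENNReal.ofReal_le_ofReal h
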